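/- For a nonnegative integer $k$ let $(x;p)_k=\prod_{j=0}^{k-1}(1-xp^{j})$ and $(x_1,\dots,x_s;p)_k=(x_1;p)_k\cdots(x_s;p)_k$; for an integer $m$ let $[m]=(1-q^m)/(1-q)$, and let $\Phi_n(q)$ be the $n$-th cyclotomic polynomial. Let $K$ be a field of characteristic $0$. For rational functions $f,g\in K(q)$ and a polynomial $P\in K[q]$, write $f\equiv g\pmod P$ if $f-g=Pu/v$ with $u,v\in K[q]$ and $v$ coprime to $P$. **Theorem.** Let $n,d$ be positive integers and $r$ an integer such that $d+n-dn\le r\le n$, $\gcd(n,d)=1$ and $n\equiv r\pmod d$. Let $c\in K$ be nonzero; $c$ may be an indeterminate (take $K=\mathbb{Q}(c)$) or a number. Suppose that $c$ is not an $n$-th root of unity other than $1$, and that $(cq^{2r};q^d)_{(n-r)/d}\neq 0$ in $K(q)$ (which is automatic if $c\ne1$). Let $M=(n-r)/d$ or $M=n-1$. Then, modulo $[n]\Phi_n(q)^4$, $$\sum_{k=0}^{M}[2dk+r]\frac{(q^r;q^d)_k^5\,(cq^r;q^d)_k}{(q^d;q^d)_k^5\,(q^d/c;q^d)_k}\Big(\frac{q^{2d-3r}}{c}\Big)^k$$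 $$\equiv[n]\,(cq^r)^{(r-n)/d}\,\frac{(cq^{2r};q^d)_{(n-r)/d}}{(q^d/c;q^d)_{(n-r)/d}}\sum_{k=0}^{(n-r)/d}\frac{(q^r;q^d)_k^2\,(q^{d-r},cq^r;q^d)_k\,q^{dk}}{(q^d;q^d)_k^3\,(cq^{2r};q^d)_k}\bigg\{1-[n]^2(2-q^n)\sum_{j=1}^{k}\Big(\frac{q^{dj}}{[dj]^2}+\frac{q^{dj-d+r}}{[dj-d+r]^2}\Big)\bigg\}.$$ -/

import Mathlib

open Polynomial

noncomputable section

/-- The `q`-shifted factorial `(x; p)_k = (1 - x)(1 - x p) ⋯ (1 - x p ^ (k - 1))`. -/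
def qPoch {F : Type*} [Field F] (x p : F) (k : ℕ) : F :=
  ∏ j ∈ Finset.range k, (1 - x * p ^ j)

/-- The `q`-integer `[m] = (1 - q ^ m) / (1 - q)`, for an arbitrary integer `m`. -/
def qInt {F : Type*} [Field F] (q : F) (m : ℤ) : F :=
  (1 - q ^ m) / (1 - q)

/-- For a natural number `n`, the `q`-integer `[n] = 1 + q + ⋯ + q ^ (n - 1)` as a polynomial
in `q`. -/
def qIntPoly (K : Type*) [Field K] (n : ℕ) : K[X] :=
  ∑ i ∈ Finset.range n, (X : K[X]) ^ i

/-- The polynomial `qIntPoly K n`, seen as a rational function, is `[n]`. -/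
theorem algebraMap_qIntPoly (K : Type*) [Field K] (n : ℕ) :
    algebraMap K[X] (RatFunc K) (qIntPoly K n) = qInt (RatFunc.X : RatFunc K) n := by
  have h : (1 : RatFunc K) - RatFunc.X ≠ 0 := by
    intro h0
    have h1 : algebraMap K[X] (RatFunc K) (1 - X) = 0 := by
      rw [map_sub, map_one, RatFunc.algebraMap_X, h0]
    have h2 : (1 - X : K[X]) = 0 :=
      (map_eq_zero_iff _ (RatFunc.algebraMap_injective K)).1 h1
    have h3 := congrArg (Polynomial.eval (0 : K)) h2
    simp at h3
  rw [qInt, qIntPoly, eq_div_iff h, map_sum]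
  simp only [map_pow, RatFunc.algebraMap_X, zpow_natCast]
  exact geom_sum_mul_neg _ _

/-- Congruence of two rational functions `f`, `g` in `q` modulo a polynomial `P` in `q`: the
difference `f - g` can be written as `P * u / v`, where `u` and `v` are polynomials and `v` is
coprime to `P`.  (For `P` nonzero this says that `P` divides the numerator of the reduced form
of `f - g`.) -/
def RatCongr {K : Type*} [Field K] (P : K[X]) (f g : RatFunc K) : Prop :=
  ∃ u v : K[X], IsCoprime v P ∧
    f - g = algebraMap K[X] (RatFunc K) (P * u) / algebraMap K[X] (RatFunc K) v

/-- The sum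
`∑_{k=0}^{M} [2dk+r] (q^r;q^d)_k^5 (cq^r;q^d)_k / ((q^d;q^d)_k^5 (q^d/c;q^d)_k) (q^(2d-3r)/c)^k`. -/
def lhsSum {F : Type*} [Field F] (q c : F) (d : ℕ) (r : ℤ) (M : ℕ) : F :=
  ∑ k ∈ Finset.range (M + 1),
    qInt q (2 * d * k + r) *
      (qPoch (q ^ r) (q ^ d) k ^ 5 * qPoch (c * q ^ r) (q ^ d) k /
        (qPoch (q ^ d) (q ^ d) k ^ 5 * qPoch (q ^ d / c) (q ^ d) k)) *
      (q ^ (2 * (d : ℤ) - 3 * r) / c) ^ k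

/-- The inner sum `∑_{j=1}^{k} (q^(dj) / [dj]^2 + q^(dj-d+r) / [dj-d+r]^2)`. -/
def harmSum {F : Type*} [Field F] (q : F) (d : ℕ) (r : ℤ) (k : ℕ) : F :=
  ∑ j ∈ Finset.Icc 1 k,
    (q ^ (d * j) / qInt q (d * j) ^ 2 +
      q ^ ((d : ℤ) * j - d + r) / qInt q ((d : ℤ) * j - d + r) ^ 2)

/-- The right-hand side, where `N` is the number `(n - r) / d`:
`[n] (cq^r)^((r-n)/d) (cq^(2r);q^d)_N / (q^d/c;q^d)_N` times the sum over `0 ≤ k ≤ N` of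
`(q^r;q^d)_k^2 (q^(d-r);q^d)_k (cq^r;q^d)_k q^(dk) / ((q^d;q^d)_k^3 (cq^(2r);q^d)_k)`
times `1 - [n]^2 (2 - q^n) ∑_{j=1}^{k} (q^(dj) / [dj]^2 + q^(dj-d+r) / [dj-d+r]^2)`. -/
def rhsSum {F : Type*} [Field F] (q c : F) (n d : ℕ) (r : ℤ) (N : ℕ) : F :=
  qInt q n * (c * q ^ r) ^ ((r - n) / (d : ℤ)) *
    (qPoch (c * q ^ (2 * r)) (q ^ d) N / qPoch (q ^ d / c) (q ^ d) N) *
    ∑ k ∈ Finset.range (N + 1),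
      qPoch (q ^ r) (q ^ d) k ^ 2 *
          (qPoch (q ^ ((d : ℤ) - r)) (q ^ d) k * qPoch (c * q ^ r) (q ^ d) k) * q ^ (d * k) /
        (qPoch (q ^ d) (q ^ d) k ^ 3 * qPoch (c * q ^ (2 * r)) (q ^ d) k) *
      (1 - qInt q n ^ 2 * (2 - q ^ n) * harmSum q d r k)

end

/-! ### Telescoping recurrences for q-Pfaff–Saalschütz and well-poised sums. -/

section QPochhammer

variable {F : Type*} [Field F]

/-! Divisibility is tested at the roots `ζ` of the modulus in an algebraic closure: by
`ratCongr_of_van` it suffices that the difference of the two sides vanishes at each `ζ` to at least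
its multiplicity. All roots of `[n]` are simple. So order five is needed at primitive `n`-th roots
of unity, and order one at the other roots, of order `m` with `1 < m < n`.

At a root of order `m`, the left summands reduce in blocks of length `m` to multiples of one
very-well-poised sequence, supported on `0 ≤ j ≤ N % m` and antisymmetric under `j ↦ N % m - j`;
hence each block sums to zero (`van_lhsSum`). The right side vanishes because of its factor `[n]`,
once the remaining factors are shown to have no pole (`van_rhsCoeff`).

At a primitive root, write `T k` for the left summands and `E k` for the right coefficients
including the prefactor. Replacing a pair `q^a, q^a` of parameters by `q^(a+n), q^(a-n)` multiplies
the symbols by a factor `ρ` (for `a = r`) or `δ` (for `a = d`), where `ρ = 1 + εA + O(ε²)`, `δ = 1 +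
εB + O(ε²)` and `ε = 2 - q^n - q^(-n)` vanishes to order two. Watson's transformation applies
exactly to two perturbed sums (`sum_lhs_pert`): `∑ T ρ/δ = ∑ E ρ` and `∑ T (ρ/δ)² = ∑ E ρ/δ`. From
`1 = 2x - x² + (x - 1)²` with `x = ρ/δ`, `∑ T = ∑ E ρ (2 - 1/δ) + ∑ T (ρ/δ - 1)²`. In the first sum
`ρ (2 - 1/δ) = 1 + ε(A + B) + O(ε²)`, and `E` supplies a fifth zero. The second is `ε² ∑ T (A - B)²`
up to order six, and this last sum vanishes at `ζ` because `T` is antisymmetric and `A - B`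
symmetric under `k ↦ N - k`. Finally `-ε` agrees with `(1 - q^n)² (2 - q^n)` to order four. This is
assembled in `van_sum_sub_sum`. -/

@[simp] lemma qPoch_zero (x p : F) : qPoch x p 0 = 1 := by simp [qPoch]

lemma qPoch_succ (x p : F) (k : ℕ) : qPoch x p (k + 1) = qPoch x p k * (1 - x * p ^ k) := by
  simp [qPoch, Finset.prod_range_succ]

lemma qPoch_add (x p : F) (k l : ℕ) :
    qPoch x p (k + l) = qPoch x p k * qPoch (x * p ^ k) p l := by
  simp only [qPoch, Finset.prod_range_add]
  congr 1
  exact Finset.prod_congr rfl fun j _ => by rw [pow_add]; ring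

lemma qPoch_succ' (x p : F) (k : ℕ) : qPoch x p (k + 1) = (1 - x) * qPoch (x * p) p k := by
  rw [add_comm, qPoch_add]; simp [qPoch]

lemma qPoch_ne_zero_iff (x p : F) (k : ℕ) : qPoch x p k ≠ 0 ↔ ∀ j < k, 1 - x * p ^ j ≠ 0 := by
  simp [qPoch, Finset.prod_ne_zero_iff]

lemma qPoch_ne_zero_of_le {x p : F} {k l : ℕ} (h : qPoch x p l ≠ 0) (hkl : k ≤ l) :
    qPoch x p k ≠ 0 := by
  rw [qPoch_ne_zero_iff] at *
  exact fun j hj => h j (by omega)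

lemma qPoch_shift (x p : F) (j : ℕ) :
    qPoch x p j * (1 - x * p ^ j) = (1 - x) * qPoch (x * p) p j := by
  rw [← qPoch_succ, qPoch_succ']

lemma qPoch_inv_pow_eq_zero {p : F} (hp : p ≠ 0) {k j : ℕ} (h : k < j) :
    qPoch (p ^ k)⁻¹ p j = 0 := by
  rw [qPoch, Finset.prod_eq_zero_iff]
  exact ⟨k, by simpa using h, by simp [hp]⟩

/-- The summand of the `q`-Pfaff–Saalschütz sum. -/
def saalTerm (p α l B C : F) (k j : ℕ) : F :=
  qPoch (p ^ k)⁻¹ p j * qPoch (α * p ^ k) p j * qPoch l p j * p ^ j /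
    (qPoch p p j * qPoch B p j * qPoch C p j)

/-- A q-Zeilberger certificate: this combination of the summands for `k + 1` and `k` is a difference
in `j`, so its partial sums have closed form. The condition `hBC` is the Saalschütz balancing
condition. -/
lemma saalTerm_partial {p α l B C : F} (hp : p ≠ 0) (hBC : B * C = α * p * l) (k J : ℕ)
    (h1 : qPoch p p J ≠ 0) (h2 : qPoch B p J ≠ 0) (h3 : qPoch C p J ≠ 0) :
    ∑ j ∈ Finset.range (J + 1), ((1 - B * p ^ k) * (1 - C * p ^ k) * saalTerm p α l B C (k + 1) j -
        (l - (B + C) * p ^ k + α * p * (p ^ k) ^ 2) * saalTerm p α l B C k j) =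
      (1 - α * p * (p ^ k) ^ 2) * (qPoch (p ^ k)⁻¹ p J * qPoch (α * p ^ (k + 1)) p J *
        qPoch l p (J + 1) / (qPoch p p J * qPoch B p J * qPoch C p J)) := by
  induction J with
  | zero =>
    simp [saalTerm, qPoch_succ]
    linear_combination (p ^ k) ^ 2 * hBC
  | succ J ih =>
    have h1' := qPoch_ne_zero_of_le h1 J.le_succ
    have h2' := qPoch_ne_zero_of_le h2 J.le_succ
    have h3' := qPoch_ne_zero_of_le h3 J.le_succ
    rw [Finset.sum_range_succ, ih h1' h2' h3']
    have e1 : qPoch (p ^ (k + 1))⁻¹ p (J + 1) = (1 - (p ^ (k + 1))⁻¹) * qPoch (p ^ k)⁻¹ p J := by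
      rw [qPoch_succ']; congr 2; rw [pow_succ]; field_simp
    have e2 : qPoch (α * p ^ k) p (J + 1) = (1 - α * p ^ k) * qPoch (α * p ^ (k + 1)) p J := by
      rw [qPoch_succ']; congr 2; ring
    simp only [saalTerm]
    rw [e1, e2]
    rw [qPoch_succ] at h1 h2 h3
    have g1 := right_ne_zero_of_mul h1
    have g2 := right_ne_zero_of_mul h2
    have g3 := right_ne_zero_of_mul h3
    rw [qPoch_succ l p (J + 1), qPoch_succ l p J, qPoch_succ p p J, qPoch_succ B p J,
      qPoch_succ C p J, qPoch_succ _ p J, qPoch_succ _ p J]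
    generalize qPoch p p J = P1 at *
    generalize qPoch B p J = P2 at *
    generalize qPoch C p J = P3 at *
    generalize qPoch l p J = P4 at *
    generalize qPoch (α * p ^ (k + 1)) p J = P5 at *
    generalize qPoch (p ^ k)⁻¹ p J = P6 at *
    have hx : p ^ k ≠ 0 := pow_ne_zero _ hp
    simp only [pow_succ] at *
    generalize p ^ k = x at *
    generalize p ^ J = y at *
    have g2' : 1 - y * B ≠ 0 := by rwa [mul_comm y]
    have g3' : 1 - y * C ≠ 0 := by rwa [mul_comm y]
    rw [← sub_eq_zero]
    field_simp
    linear_combination P6 * P5 * P4 * (1 - l * y) *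
      (x * y ^ 2 * (1 - α * p * x ^ 2) * (1 - p * y) +
        y * x ^ 2 * (p * x - 1) * (1 - α * p * x * y)) * hBC

/-- The `q`-Pfaff–Saalschütz sum, in the form of a connection formula. -/
lemma sum_saalTerm {p α l β γ : F} (hp : p ≠ 0) (hα : l * β * γ = α * p) (k : ℕ)
    (h1 : qPoch p p k ≠ 0) (h2 : qPoch (l * γ) p k ≠ 0) (h3 : qPoch (l * β) p k ≠ 0) :
    ∑ j ∈ Finset.range (k + 1), saalTerm p α l (l * γ) (l * β) k j =
      qPoch β p k * qPoch γ p k * l ^ k / (qPoch (l * γ) p k * qPoch (l * β) p k) := by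
  induction k with
  | zero => simp [saalTerm]
  | succ k ih =>
    have ih := ih (qPoch_ne_zero_of_le h1 k.le_succ) (qPoch_ne_zero_of_le h2 k.le_succ)
      (qPoch_ne_zero_of_le h3 k.le_succ)
    -- At `J = k + 1` the boundary term contains `qPoch (p ^ k)⁻¹ p (k + 1) = 0`, leaving a
    -- first-order recurrence in `k`.
    have key := saalTerm_partial (α := α) hp
      (show (l * γ) * (l * β) = α * p * l by rw [← hα]; ring) k (k + 1) h1 h2 h3
    have hz : saalTerm p α l (l * γ) (l * β) k (k + 1) = 0 := by
      simp [saalTerm, qPoch_inv_pow_eq_zero hp k.lt_succ_self]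
    rw [qPoch_inv_pow_eq_zero hp k.lt_succ_self, Finset.sum_sub_distrib, ← Finset.mul_sum,
      ← Finset.mul_sum, Finset.sum_range_succ (fun j => saalTerm p α l (l * γ) (l * β) k j), hz,
      add_zero, ih] at key
    rw [qPoch_succ] at h2 h3
    have g2 := right_ne_zero_of_mul h2
    have g3 := right_ne_zero_of_mul h3
    have f2 := left_ne_zero_of_mul h2
    have f3 := left_ne_zero_of_mul h3
    apply mul_left_cancel₀ (mul_ne_zero g2 g3)
    simp only [qPoch_succ _ p k]
    generalize hB : l * γ = B at *
    generalize hC : l * β = C at *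
    rw [zero_mul, zero_mul, zero_div, mul_zero, sub_eq_zero] at key
    rw [key, pow_succ l]
    have e : l - (B + C) * p ^ k + α * p * (p ^ k) ^ 2 =
        (1 - β * p ^ k) * (1 - γ * p ^ k) * l := by
      linear_combination (p ^ k - γ * (p ^ k) ^ 2) * hC + p ^ k * hB - (p ^ k) ^ 2 * hα
    rw [e]
    generalize hd : 1 - B * p ^ k = b at *
    generalize hd' : 1 - C * p ^ k = c at *
    field_simp

lemma ratio_step_aux {F : Type*} [Field F] {P1 P2 P3 P4 b' c' d' u : F}
    (Q1 Q2 Q3 Q4 M R a b c d t m s : F) (f1 : P1 ≠ 0) (f2 : P2 ≠ 0) (f3 : P3 ≠ 0) (f4 : P4 ≠ 0)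
    (k1 : d' ≠ 0) (k2 : b' ≠ 0) (k3 : c' ≠ 0) (k4 : u ≠ 0) :
    Q1 * a * (Q2 * b * (Q3 * c) * (Q4 * d)) /
        (P1 * u * (P2 * b' * (P3 * c') * (P4 * d'))) * (M * m) * (R * s) * (b' * c' * d' * t) =
      Q1 * Q2 * Q3 * Q4 * M / (P1 * P2 * P3 * P4) * (b * c * d * m) * (a * s) * (R * t) / u := by
  have n1 : P1 * u * (P2 * b' * (P3 * c') * (P4 * d')) ≠ 0 := by
    simp only [ne_eq, mul_eq_zero, not_or]; exact ⟨⟨f1, k4⟩, ⟨⟨f2, k2⟩, f3, k3⟩, f4, k1⟩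
  have n2 : P1 * P2 * P3 * P4 ≠ 0 := by
    simp only [ne_eq, mul_eq_zero, not_or]; exact ⟨⟨⟨f1, f2⟩, f3⟩, f4⟩
  rw [div_mul_eq_mul_div, div_mul_eq_mul_div, div_mul_eq_mul_div, div_mul_eq_mul_div,
    div_mul_eq_mul_div, div_mul_eq_mul_div, div_div, div_eq_div_iff n1 (mul_ne_zero n2 k4)]
  ring

/-- The summand of a terminating very-well-poised series, without its very-well-poised part. -/
def wpTerm (p α δ e : F) (N j k : ℕ) : F :=
  qPoch α p k * (qPoch δ p k * qPoch e p k * qPoch (p ^ N)⁻¹ p k) /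
    (qPoch p p k * (qPoch (α * p / δ) p k * qPoch (α * p / e) p k * qPoch (α * p ^ (N + 1)) p k)) *
    (α * p ^ (N + 1) / (δ * e)) ^ k * (qPoch (p ^ k)⁻¹ p j * qPoch (α * p ^ k) p j)

/-- The ratio of consecutive terms is kept cross-multiplied because `qPoch (p ^ k)⁻¹ p j` and `p * p
^ k - p ^ j` may both vanish. -/
lemma wpTerm_succ {p α δ e : F} (hp : p ≠ 0) (N j k : ℕ)
    (h1 : qPoch p p (k + 1) ≠ 0) (h2 : qPoch (α * p / δ) p (k + 1) ≠ 0)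
    (h3 : qPoch (α * p / e) p (k + 1) ≠ 0) (h4 : qPoch (α * p ^ (N + 1)) p (k + 1) ≠ 0) :
    wpTerm p α δ e N j (k + 1) * ((1 - α * p / δ * p ^ k) * (1 - α * p / e * p ^ k) *
        (1 - α * p ^ (N + 1) * p ^ k) * (p * p ^ k - p ^ j)) =
      - (wpTerm p α δ e N j k * ((1 - δ * p ^ k) * (1 - e * p ^ k) * (1 - p ^ k / p ^ N) *
        (α * p ^ (N + 1) / (δ * e)) * (1 - α * p ^ k * p ^ j))) := by
  have e1 := qPoch_shift (p ^ (k + 1))⁻¹ p j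
  have e2 := qPoch_shift (α * p ^ k) p j
  have e3 : (p ^ (k + 1))⁻¹ * p = (p ^ k)⁻¹ := by rw [pow_succ]; field_simp
  rw [e3] at e1
  have e4 : α * p ^ k * p = α * p ^ (k + 1) := by ring
  rw [e4] at e2
  simp only [wpTerm]
  rw [qPoch_succ] at h1 h2 h3 h4
  have g1 := right_ne_zero_of_mul h1
  have g2 := right_ne_zero_of_mul h2
  have g3 := right_ne_zero_of_mul h3
  have g4 := right_ne_zero_of_mul h4
  have f1 := left_ne_zero_of_mul h1
  have f2 := left_ne_zero_of_mul h2
  have f3 := left_ne_zero_of_mul h3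
  have f4 := left_ne_zero_of_mul h4
  simp only [qPoch_succ _ p k, pow_succ _ k] at *
  generalize α * p ^ (N + 1) / (δ * e) = μ at *
  generalize α * p / δ = D at *
  generalize α * p / e = E at *
  generalize α * p ^ (N + 1) = A at *
  have hx : p ^ k ≠ 0 := pow_ne_zero _ hp
  generalize qPoch p p k = P1 at *
  generalize qPoch D p k = P2 at *
  generalize qPoch E p k = P3 at *
  generalize qPoch A p k = P4 at *
  generalize qPoch α p k = Q1 at *
  generalize qPoch δ p k = Q2 at *
  generalize qPoch e p k = Q3 at *
  generalize qPoch (p ^ N)⁻¹ p k = Q4 at *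
  generalize qPoch (p ^ k)⁻¹ p j = R1 at *
  generalize qPoch (p ^ k * p)⁻¹ p j = R2 at *
  generalize qPoch (α * p ^ k) p j = R3 at *
  generalize qPoch (α * (p ^ k * p)) p j = R4 at *
  have e1' : R2 * (p * p ^ k - p ^ j) = - (1 - p * p ^ k) * R1 := by
    field_simp at e1
    linear_combination e1
  generalize μ ^ k = M at *
  generalize p ^ k = x at *
  rw [ratio_step_aux _ _ _ _ _ _ _ _ _ _ _ _ _ f1 f2 f3 f4 g4 g2 g3 g1, e1', ← e2, inv_mul_eq_div]
  have e5 : ∀ Y Z : F, Y * Z * (-(1 - p * x) * R1) / (1 - p * x) = -(Y * Z * R1) := by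
    intro Y Z
    rw [div_eq_iff g1]; ring
  rw [e5]
  ring

/-- Passing from `j` to `j + 1` multiplies the term by `(1 - p^j / p^k)(1 - α p^k p^j)`; the
resulting contiguous relation telescopes in `k`. -/
lemma wpTerm_partial {p α δ e : F} (hp : p ≠ 0) (hα : α ≠ 0) (hδ : δ ≠ 0) (he : e ≠ 0) (N j K : ℕ)
    (h1 : qPoch p p K ≠ 0) (h2 : qPoch (α * p / δ) p K ≠ 0)
    (h3 : qPoch (α * p / e) p K ≠ 0) (h4 : qPoch (α * p ^ (N + 1)) p K ≠ 0) :
    ∑ k ∈ Finset.range (K + 1), (1 - α * (p ^ k) ^ 2) *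
        ((1 - δ * e / (α * p ^ N) * p ^ j) * wpTerm p α δ e N (j + 1) k -
          (1 - δ * p ^ j) * (1 - e * p ^ j) * (1 - p ^ j / p ^ N) * wpTerm p α δ e N j k) =
      - (p ^ j * wpTerm p α δ e N j K / p ^ K * ((1 - δ * p ^ K) * (1 - e * p ^ K) *
        (1 - p ^ K / p ^ N) * (1 - α * p ^ K * p ^ j))) := by
  have hs : ∀ k, wpTerm p α δ e N (j + 1) k =
      wpTerm p α δ e N j k * ((1 - p ^ j / p ^ k) * (1 - α * p ^ k * p ^ j)) := by
    intro k
    simp only [wpTerm, qPoch_succ _ p j]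
    ring
  simp only [hs]
  clear hs
  induction K with
  | zero =>
    rcases j with _ | j
    · simp; ring
    · have : wpTerm p α δ e N (j + 1) 0 = 0 := by
        simp [wpTerm, qPoch_succ']
      simp [this]
  | succ K ih =>
    rw [Finset.sum_range_succ, ih (qPoch_ne_zero_of_le h1 K.le_succ)
      (qPoch_ne_zero_of_le h2 K.le_succ) (qPoch_ne_zero_of_le h3 K.le_succ)
      (qPoch_ne_zero_of_le h4 K.le_succ)]
    have key := wpTerm_succ hp N j K h1 h2 h3 h4
    generalize wpTerm p α δ e N j (K + 1) = T1 at *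
    generalize wpTerm p α δ e N j K = T0 at *
    have hx : p ^ K ≠ 0 := pow_ne_zero _ hp
    have hy : p ^ j ≠ 0 := pow_ne_zero _ hp
    have hN : p ^ N ≠ 0 := pow_ne_zero _ hp
    simp only [pow_succ _ K, pow_succ _ N] at *
    clear ih h1 h2 h3 h4
    generalize p ^ K = x at *
    generalize p ^ j = y at *
    generalize p ^ N = z at *
    have key' : T0 * ((1 - δ * x) * (1 - e * x) * (1 - x / z) * (1 - α * x * y)) =
        - (T1 * ((1 - α * p / δ * x) * (1 - α * p / e * x) * (1 - α * (z * p) * x) * (p * x - y)) *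
          (δ * e / (α * (z * p)))) := by
      rw [key]; field_simp
    have e0 : y * T0 / x * ((1 - δ * x) * (1 - e * x) * (1 - x / z) * (1 - α * x * y)) =
      y / x * (T0 * ((1 - δ * x) * (1 - e * x) * (1 - x / z) * (1 - α * x * y))) := by ring
    rw [e0, key']
    field_simp
    ring

end QPochhammer

/-! ### Watson's transformation. -/

section Watson

variable {F : Type*} [Field F]

lemma qPoch_reflect {p : F} (hp : p ≠ 0) {a : F} (ha : a ≠ 0) (N : ℕ) :
    qPoch (p / (a * p ^ N)) p N * a ^ N = qPoch a p N * ∏ i ∈ Finset.range N, (-(p ^ i)⁻¹) := by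
  rw [qPoch, ← Finset.prod_range_reflect, qPoch, ← Finset.prod_mul_distrib]
  have : a ^ N = ∏ _i ∈ Finset.range N, a := by simp
  rw [this]
  rw [← Finset.prod_mul_distrib]
  refine Finset.prod_congr rfl fun i hi => ?_
  obtain ⟨m, rfl⟩ : ∃ m, N = i + 1 + m := ⟨N - (i + 1), by
    have := Finset.mem_range.1 hi; omega⟩
  have e : i + 1 + m - 1 - i = m := by omega
  rw [e]
  have h1 : p ^ i ≠ 0 := pow_ne_zero _ hp
  have h2 : p ^ m ≠ 0 := pow_ne_zero _ hp
  rw [pow_add, pow_add, pow_one]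
  field_simp
  ring

/-- The signs and powers of `p` produced by reversing the product do not depend on the parameter, so
they cancel between `a` and `b`. -/
lemma qPoch_reflect_mul {p : F} (hp : p ≠ 0) {a b : F} (ha : a ≠ 0) (hb : b ≠ 0) (N : ℕ) :
    qPoch (p / (a * p ^ N)) p N * a ^ N * qPoch b p N =
      qPoch (p / (b * p ^ N)) p N * b ^ N * qPoch a p N := by
  rw [qPoch_reflect hp ha, qPoch_reflect hp hb]; ring

/-- The closed form of a terminating very-well-poised `₆φ₅` series, started at index `j`. -/
lemma sum_wpTerm {p α e : F} (hp : p ≠ 0) (hα : α ≠ 0) (he : e ≠ 0) (N : ℕ)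
    (h1 : qPoch p p N ≠ 0) (h2 : qPoch (α * p / (α ^ 2 * p ^ N)) p N ≠ 0)
    (h3 : qPoch (α * p / e) p N ≠ 0) (h4 : qPoch (α * p ^ (N + 1)) p N ≠ 0)
    (h5 : qPoch (α ^ 2 * p ^ N) p N ≠ 0) (h6 : qPoch e p N ≠ 0) {j : ℕ} (hj : j ≤ N) :
    (∑ k ∈ Finset.range (N + 1), (1 - α * (p ^ k) ^ 2) * wpTerm p α (α ^ 2 * p ^ N) e N j k) *
        qPoch (α * e) p j =
      (1 - α * p ^ N) * (qPoch (α * e) p N / qPoch (α * p / e) p N) / e ^ N *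
        (qPoch (α ^ 2 * p ^ N) p j * qPoch e p j * qPoch (p ^ N)⁻¹ p j) := by
  have hN : p ^ N ≠ 0 := pow_ne_zero _ hp
  induction hj using Nat.decreasingInduction with
  | self =>
    -- For `j = N` the factor `qPoch (p ^ k)⁻¹ p N` kills every term with `k < N`.
    rw [Finset.sum_eq_single_of_mem N (by simp)]
    · have e1 := qPoch_reflect_mul hp hα hp N
      have e2 := qPoch_shift (α * p ^ N) p N
      have e3 : p / (p * p ^ N) = (p ^ N)⁻¹ := by field_simp
      have e4 : α * p / (α ^ 2 * p ^ N) = p / (α * p ^ N) := by field_simp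
      have e5 : α * p ^ N * p = α * p ^ (N + 1) := by ring
      have e6 : α * p ^ (N + 1) / (α ^ 2 * p ^ N * e) = p / (α * e) := by
        rw [pow_succ]; field_simp
      rw [e3] at e1
      rw [e5] at e2
      rw [e4] at h2
      simp only [wpTerm, e4, e6]
      have e7 : 1 - α * (p ^ N) ^ 2 = 1 - α * p ^ N * p ^ N := by ring
      rw [e7, div_pow, mul_pow]
      have hαN : α ^ N ≠ 0 := pow_ne_zero _ hα
      have heN : e ^ N ≠ 0 := pow_ne_zero _ he
      generalize 1 - α * p ^ N * p ^ N = u at *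
      generalize 1 - α * p ^ N = v at *
      generalize qPoch (p ^ N)⁻¹ p N = Q1 at *
      generalize qPoch p p N = Q2 at *
      generalize qPoch (α ^ 2 * p ^ N) p N = Q3 at *
      generalize qPoch (p / (α * p ^ N)) p N = Q4 at *
      generalize qPoch (α * p ^ N) p N = Q5 at *
      generalize qPoch (α * p ^ (N + 1)) p N = Q6 at *
      generalize qPoch (α * p / e) p N = Q7 at *
      generalize qPoch (α * e) p N = Q8 at *
      generalize qPoch α p N = Q9 at *
      field_simp
      linear_combination Q1 * Q8 * (Q1 * Q9 * p ^ N * e2 - v * Q6 * e1)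
    · intro k hk hkN
      have : k < N := by have := Finset.mem_range.1 hk; omega
      simp [wpTerm, qPoch_inv_pow_eq_zero hp this]
  | of_succ j hj ih =>
    have key := wpTerm_partial hp hα (mul_ne_zero (pow_ne_zero 2 hα) hN) he N j N h1 h2 h3 h4
    -- The boundary term at `K = N` carries `1 - p^N / p^N`, so the contiguous relation becomes a
    -- recurrence in `j`, to be run downwards.
    rw [div_self hN, sub_self] at key
    have e1 : α ^ 2 * p ^ N * e / (α * p ^ N) = α * e := by field_simp
    have e2 : ∀ k, (1 - α * (p ^ k) ^ 2) *
        ((1 - α * e * p ^ j) * wpTerm p α (α ^ 2 * p ^ N) e N (j + 1) k -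
          (1 - α ^ 2 * p ^ N * p ^ j) * (1 - e * p ^ j) * (1 - p ^ j / p ^ N) *
            wpTerm p α (α ^ 2 * p ^ N) e N j k) =
        (1 - α * e * p ^ j) * ((1 - α * (p ^ k) ^ 2) * wpTerm p α (α ^ 2 * p ^ N) e N (j + 1) k) -
        ((1 - α ^ 2 * p ^ N * p ^ j) * (1 - e * p ^ j) * (1 - p ^ j / p ^ N)) *
          ((1 - α * (p ^ k) ^ 2) * wpTerm p α (α ^ 2 * p ^ N) e N j k) := by
      intro k; ring
    rw [e1] at key
    simp only [e2] at key
    rw [Finset.sum_sub_distrib, ← Finset.mul_sum, ← Finset.mul_sum] at key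
    simp only [qPoch_succ _ p j] at ih
    have g1 := (qPoch_ne_zero_iff _ _ _).1 h5 j hj
    have g2 := (qPoch_ne_zero_iff _ _ _).1 h6 j hj
    have g3 : 1 - p ^ j / p ^ N ≠ 0 := by
      have := (qPoch_ne_zero_iff _ _ _).1 h1 (N - j - 1) (by omega)
      rw [← pow_succ', show N - j - 1 + 1 = N - j by omega] at this
      intro h
      apply this
      have hj' : p ^ j ≠ 0 := pow_ne_zero _ hp
      rw [pow_sub₀ _ hp hj.le]
      rw [sub_eq_zero, eq_div_iff hN] at h
      rw [sub_eq_zero, eq_comm, mul_inv_eq_one₀ hj']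
      linear_combination h
    apply mul_left_cancel₀ (mul_ne_zero (mul_ne_zero g1 g2) g3)
    linear_combination ih - qPoch (α * e) p j * key

/-- Watson's transformation of a terminating very-well-poised `₈φ₇` series into a balanced `₄φ₃`
series, with one parameter specialised to `α ^ 2 p ^ N`. -/
lemma watson {p α e l β γ : F} (hp : p ≠ 0) (hα : α ≠ 0) (he : e ≠ 0) (N : ℕ)
    (hl : l * β * γ = α * p)
    (h1 : qPoch p p N ≠ 0) (h2 : qPoch (α * p / (α ^ 2 * p ^ N)) p N ≠ 0)
    (h3 : qPoch (α * p / e) p N ≠ 0) (h4 : qPoch (α * p ^ (N + 1)) p N ≠ 0)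
    (h5 : qPoch (α ^ 2 * p ^ N) p N ≠ 0) (h6 : qPoch e p N ≠ 0)
    (h7 : qPoch (l * γ) p N ≠ 0) (h8 : qPoch (l * β) p N ≠ 0) (h9 : qPoch (α * e) p N ≠ 0) :
    ∑ k ∈ Finset.range (N + 1), (1 - α * (p ^ k) ^ 2) *
      (wpTerm p α (α ^ 2 * p ^ N) e N 0 k *
        (qPoch β p k * qPoch γ p k * l ^ k / (qPoch (l * γ) p k * qPoch (l * β) p k))) =
    (1 - α * p ^ N) * (qPoch (α * e) p N / qPoch (α * p / e) p N) / e ^ N *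
      ∑ j ∈ Finset.range (N + 1), qPoch (α ^ 2 * p ^ N) p j * qPoch e p j * qPoch (p ^ N)⁻¹ p j *
        qPoch l p j * p ^ j / (qPoch p p j * qPoch (l * γ) p j * qPoch (l * β) p j *
          qPoch (α * e) p j) := by
  have e1 : ∀ k ∈ Finset.range (N + 1), (1 - α * (p ^ k) ^ 2) *
      (wpTerm p α (α ^ 2 * p ^ N) e N 0 k *
        (qPoch β p k * qPoch γ p k * l ^ k / (qPoch (l * γ) p k * qPoch (l * β) p k))) =
      ∑ j ∈ Finset.range (N + 1), (qPoch l p j * p ^ j /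
        (qPoch p p j * qPoch (l * γ) p j * qPoch (l * β) p j)) *
        ((1 - α * (p ^ k) ^ 2) * wpTerm p α (α ^ 2 * p ^ N) e N j k) := by
    intro k hk
    have hk' : k ≤ N := by have := Finset.mem_range.1 hk; omega
    -- Saalschütz expands the `β, γ` part as a sum over `j ≤ k`; extending it by zeros to `j ≤ N`
    -- allows the two summations to be exchanged, and the sum over `k` is then `sum_wpTerm`.
    rw [← sum_saalTerm hp hl k (qPoch_ne_zero_of_le h1 hk') (qPoch_ne_zero_of_le h7 hk')
      (qPoch_ne_zero_of_le h8 hk'), Finset.mul_sum, Finset.mul_sum]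
    have hsub : Finset.range (k + 1) ⊆ Finset.range (N + 1) :=
      Finset.range_subset_range.2 (by omega)
    rw [← Finset.sum_subset hsub (f := fun j => (qPoch l p j * p ^ j /
        (qPoch p p j * qPoch (l * γ) p j * qPoch (l * β) p j)) *
        ((1 - α * (p ^ k) ^ 2) * wpTerm p α (α ^ 2 * p ^ N) e N j k))]
    · refine Finset.sum_congr rfl fun j _ => ?_
      simp only [wpTerm, saalTerm, qPoch_zero]
      ring
    · intro j _ hj
      have : k < j := by simpa using hj
      simp [wpTerm, qPoch_inv_pow_eq_zero hp this]
  rw [Finset.sum_congr rfl e1, Finset.sum_comm, Finset.mul_sum]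
  refine Finset.sum_congr rfl fun j hj => ?_
  have hj' : j ≤ N := by have := Finset.mem_range.1 hj; omega
  rw [← Finset.mul_sum]
  have key := sum_wpTerm hp hα he N h1 h2 h3 h4 h5 h6 hj'
  rw [← eq_div_iff (qPoch_ne_zero_of_le h9 hj')] at key
  rw [key]
  ring

end Watson

/-! ### Values and orders of vanishing at a point of an extension field. -/

section Local

variable {K L : Type*} [Field K] [Field L] [Algebra K L]

/-- The rational function `x` is defined at `ζ` with value `y`. -/
def Red (ζ : L) (x : RatFunc K) (y : L) : Prop :=
  ∃ u v : K[X], aeval ζ v ≠ 0 ∧ y = aeval ζ u / aeval ζ v ∧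
    x = algebraMap K[X] (RatFunc K) u / algebraMap K[X] (RatFunc K) v

/-- The rational function `x` is defined at `ζ` and vanishes there to order at least `e`. -/
def Van (ζ : L) (e : ℕ) (x : RatFunc K) : Prop :=
  ∃ u v : K[X], aeval ζ v ≠ 0 ∧ (X - C ζ) ^ e ∣ u.map (algebraMap K L) ∧
    x = algebraMap K[X] (RatFunc K) u / algebraMap K[X] (RatFunc K) v

variable {ζ : L}

lemma algebraMap_ne_zero_of_aeval {v : K[X]} (hv : aeval ζ v ≠ 0) :
    algebraMap K[X] (RatFunc K) v ≠ 0 := by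
  intro h
  rw [map_eq_zero_iff _ (RatFunc.algebraMap_injective K)] at h
  simp [h] at hv

lemma Red.poly (u : K[X]) : Red ζ (algebraMap K[X] (RatFunc K) u) (aeval ζ u) :=
  ⟨u, 1, by simp, by simp, by simp⟩

lemma Red.const (c : K) : Red ζ (RatFunc.C c) (algebraMap K L c) := by
  simpa using Red.poly (ζ := ζ) (C c)

lemma Red.var : Red ζ (RatFunc.X : RatFunc K) ζ := by
  simpa using Red.poly (K := K) (ζ := ζ) X

lemma Red.one : Red ζ (1 : RatFunc K) 1 := by
  simpa using Red.poly (ζ := ζ) (1 : K[X])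

lemma Red.zero : Red ζ (0 : RatFunc K) 0 := by
  simpa using Red.poly (ζ := ζ) (0 : K[X])

lemma Red.natCast (n : ℕ) : Red ζ (n : RatFunc K) n := by
  simpa using Red.poly (ζ := ζ) (n : K[X])

lemma Red.add {x x' : RatFunc K} {y y' : L} (h : Red ζ x y) (h' : Red ζ x' y') :
    Red ζ (x + x') (y + y') := by
  obtain ⟨u, v, hv, hy, hx⟩ := h
  obtain ⟨u', v', hv', hy', hx'⟩ := h'
  have g := algebraMap_ne_zero_of_aeval hv
  have g' := algebraMap_ne_zero_of_aeval hv'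
  refine ⟨u * v' + v * u', v * v', by simp [hv, hv'], ?_, ?_⟩
  · rw [hy, hy', div_add_div _ _ hv hv']; simp
  · rw [hx, hx', div_add_div _ _ g g']; simp

lemma Red.mul {x x' : RatFunc K} {y y' : L} (h : Red ζ x y) (h' : Red ζ x' y') :
    Red ζ (x * x') (y * y') := by
  obtain ⟨u, v, hv, hy, hx⟩ := h
  obtain ⟨u', v', hv', hy', hx'⟩ := h'
  refine ⟨u * u', v * v', by simp [hv, hv'], ?_, ?_⟩
  · rw [hy, hy', div_mul_div_comm]; simp
  · rw [hx, hx', div_mul_div_comm]; simp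

lemma Red.neg {x : RatFunc K} {y : L} (h : Red ζ x y) : Red ζ (-x) (-y) := by
  obtain ⟨u, v, hv, hy, hx⟩ := h
  exact ⟨-u, v, hv, by rw [hy]; simp [neg_div], by rw [hx]; simp [neg_div]⟩

lemma Red.sub {x x' : RatFunc K} {y y' : L} (h : Red ζ x y) (h' : Red ζ x' y') :
    Red ζ (x - x') (y - y') := by
  simpa [sub_eq_add_neg] using h.add h'.neg

lemma Red.inv {x : RatFunc K} {y : L} (h : Red ζ x y) (hy0 : y ≠ 0) : Red ζ x⁻¹ y⁻¹ := by
  obtain ⟨u, v, hv, hy, hx⟩ := h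
  refine ⟨v, u, ?_, by rw [hy, inv_div], by rw [hx, inv_div]⟩
  rintro hu
  simp [hy, hu] at hy0

lemma Red.div {x x' : RatFunc K} {y y' : L} (h : Red ζ x y) (h' : Red ζ x' y') (hy : y' ≠ 0) :
    Red ζ (x / x') (y / y') := by
  simpa [div_eq_mul_inv] using h.mul (h'.inv hy)

lemma Red.pow {x : RatFunc K} {y : L} (h : Red ζ x y) (k : ℕ) : Red ζ (x ^ k) (y ^ k) := by
  induction k with
  | zero => simpa using Red.one
  | succ k ih => rw [pow_succ, pow_succ]; exact ih.mul h

lemma Red.zpow {x : RatFunc K} {y : L} (h : Red ζ x y) (hy : y ≠ 0) (k : ℤ) :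
    Red ζ (x ^ k) (y ^ k) := by
  cases k with
  | ofNat k => simpa using h.pow k
  | negSucc k => simpa [zpow_negSucc] using (h.pow (k + 1)).inv (pow_ne_zero _ hy)

lemma Red.prod {ι : Type*} (s : Finset ι) {f : ι → RatFunc K} {g : ι → L}
    (h : ∀ i ∈ s, Red ζ (f i) (g i)) : Red ζ (∏ i ∈ s, f i) (∏ i ∈ s, g i) := by
  classical
  induction s using Finset.induction_on with
  | empty => simpa using Red.one
  | insert a s ha ih =>
    rw [Finset.prod_insert ha, Finset.prod_insert ha]
    exact (h a (by simp)).mul (ih fun i hi => h i (by simp [hi]))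

lemma Red.sum {ι : Type*} (s : Finset ι) {f : ι → RatFunc K} {g : ι → L}
    (h : ∀ i ∈ s, Red ζ (f i) (g i)) : Red ζ (∑ i ∈ s, f i) (∑ i ∈ s, g i) := by
  classical
  induction s using Finset.induction_on with
  | empty => simpa using Red.zero
  | insert a s ha ih =>
    rw [Finset.sum_insert ha, Finset.sum_insert ha]
    exact (h a (by simp)).add (ih fun i hi => h i (by simp [hi]))

lemma Red.qPoch {x p : RatFunc K} {x' p' : L} (hx : Red ζ x x') (hp : Red ζ p p') (k : ℕ) :
    Red ζ (qPoch x p k) (qPoch x' p' k) :=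
  Red.prod _ fun j _ => Red.one.sub (hx.mul (hp.pow j))

lemma Red.qInt (h0 : ζ ≠ 0) (h1 : ζ ≠ 1) (m : ℤ) :
    Red ζ (qInt (RatFunc.X : RatFunc K) m) (qInt ζ m) :=
  (Red.one.sub (Red.var.zpow h0 m)).div (Red.one.sub Red.var) (sub_ne_zero.2 h1.symm)

lemma Van.of_red {x : RatFunc K} {y : L} (h : Red ζ x y) : Van ζ 0 x := by
  obtain ⟨u, v, hv, -, hx⟩ := h
  exact ⟨u, v, hv, by simp, hx⟩

lemma Van.exists_red {x : RatFunc K} (h : Van ζ 0 x) : ∃ y, Red ζ x y := by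
  obtain ⟨u, v, hv, -, hx⟩ := h
  exact ⟨_, u, v, hv, rfl, hx⟩

lemma Van.of_red_zero {x : RatFunc K} (h : Red ζ x 0) : Van ζ 1 x := by
  obtain ⟨u, v, hv, hy, hx⟩ := h
  refine ⟨u, v, hv, ?_, hx⟩
  rw [pow_one, dvd_iff_isRoot, IsRoot, eval_map_algebraMap]
  simpa [hv] using hy.symm

lemma Van.mono {e e' : ℕ} (hee : e' ≤ e) {x : RatFunc K} (h : Van ζ e x) : Van ζ e' x := by
  obtain ⟨u, v, hv, hy, hx⟩ := h
  exact ⟨u, v, hv, (pow_dvd_pow _ hee).trans hy, hx⟩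

lemma Van.add {e : ℕ} {x x' : RatFunc K} (h : Van ζ e x) (h' : Van ζ e x') : Van ζ e (x + x') := by
  obtain ⟨u, v, hv, hy, hx⟩ := h
  obtain ⟨u', v', hv', hy', hx'⟩ := h'
  have g := algebraMap_ne_zero_of_aeval hv
  have g' := algebraMap_ne_zero_of_aeval hv'
  refine ⟨u * v' + v * u', v * v', by simp [hv, hv'], ?_, ?_⟩
  · rw [Polynomial.map_add, Polynomial.map_mul, Polynomial.map_mul]
    exact dvd_add (hy.mul_right _) (hy'.mul_left _)
  · rw [hx, hx', div_add_div _ _ g g']; simp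

lemma Van.mul {e e' : ℕ} {x x' : RatFunc K} (h : Van ζ e x) (h' : Van ζ e' x') :
    Van ζ (e + e') (x * x') := by
  obtain ⟨u, v, hv, hy, hx⟩ := h
  obtain ⟨u', v', hv', hy', hx'⟩ := h'
  refine ⟨u * u', v * v', by simp [hv, hv'], ?_, ?_⟩
  · rw [Polynomial.map_mul, pow_add]; exact mul_dvd_mul hy hy'
  · rw [hx, hx', div_mul_div_comm]; simp

lemma Van.zero (e : ℕ) : Van ζ e (0 : RatFunc K) := ⟨0, 1, by simp, by simp, by simp⟩

lemma Van.mul_left {e : ℕ} {x x' : RatFunc K} (h : Van ζ 0 x) (h' : Van ζ e x') :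
    Van ζ e (x * x') := by simpa using h.mul h'

lemma Van.mul_right {e : ℕ} {x x' : RatFunc K} (h : Van ζ e x) (h' : Van ζ 0 x') :
    Van ζ e (x * x') := by simpa using h.mul h'

lemma Van.neg {e : ℕ} {x : RatFunc K} (h : Van ζ e x) : Van ζ e (-x) := by
  simpa using (Van.of_red (Red.one.neg)).mul_left h

lemma Van.sub {e : ℕ} {x x' : RatFunc K} (h : Van ζ e x) (h' : Van ζ e x') :
    Van ζ e (x - x') := by
  simpa [sub_eq_add_neg] using h.add h'.neg

lemma Van.pow {e : ℕ} {x : RatFunc K} (h : Van ζ e x) (k : ℕ) : Van ζ (e * k) (x ^ k) := by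
  induction k with
  | zero => simpa using Van.of_red Red.one
  | succ k ih => rw [pow_succ, Nat.mul_succ]; exact ih.mul h

lemma Van.sum {ι : Type*} (s : Finset ι) {e : ℕ} {f : ι → RatFunc K}
    (h : ∀ i ∈ s, Van ζ e (f i)) : Van ζ e (∑ i ∈ s, f i) := by
  classical
  induction s using Finset.induction_on with
  | empty => simpa using Van.zero e
  | insert a s ha ih =>
    rw [Finset.sum_insert ha]
    exact (h a (by simp)).add (ih fun i hi => h i (by simp [hi]))

/-- A rational function that vanishes to the right order at every root of `P` is divisible
by `P`. -/
lemma ratCongr_of_van [IsAlgClosed L] {P : K[X]} (hP : P ≠ 0) {f g : RatFunc K}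
    (h : ∀ ζ : L, aeval ζ P = 0 →
      Van ζ ((P.map (algebraMap K L)).rootMultiplicity ζ) (f - g)) :
    RatCongr P f g := by
  set x := f - g with hx
  have hnd := RatFunc.isCoprime_num_denom x
  have key : P ∣ x.num := by
    by_cases hx0 : x = 0
    · simp [hx0]
    have hnum : x.num ≠ 0 := RatFunc.num_ne_zero hx0
    have hinj := (algebraMap K L).injective
    -- Divisibility may be tested over `L`, where `P` splits and it becomes a comparison of root
    -- multiplicities.
    rw [← Polynomial.map_dvd_map' (algebraMap K L),
      (IsAlgClosed.splits (P.map (algebraMap K L))).dvd_iff_roots_le_roots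
        ((Polynomial.map_ne_zero_iff hinj).2 hP) ((Polynomial.map_ne_zero_iff hinj).2 hnum)]
    classical
    rw [Multiset.le_iff_count]
    intro ζ
    rw [count_roots, count_roots]
    by_cases hζ : aeval ζ P = 0
    · obtain ⟨u, v, hv, hu, hxe⟩ := h ζ hζ
      have hv0 := algebraMap_ne_zero_of_aeval hv
      have hd0 : algebraMap K[X] (RatFunc K) x.denom ≠ 0 := by
        simpa using RatFunc.denom_ne_zero x
      have e1 := RatFunc.num_div_denom x
      rw [hxe, div_eq_div_iff (by simpa [hxe] using hd0) hv0] at e1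
      rw [← hxe, ← map_mul, ← map_mul] at e1
      have e2 := RatFunc.algebraMap_injective K e1
      rw [le_rootMultiplicity_iff ((Polynomial.map_ne_zero_iff hinj).2 hnum)]
      have e3 : (X - C ζ) ^ (rootMultiplicity ζ (P.map (algebraMap K L))) ∣
          x.num.map (algebraMap K L) * v.map (algebraMap K L) := by
        rw [← Polynomial.map_mul, e2, Polynomial.map_mul]
        exact hu.mul_right _
      refine IsCoprime.dvd_of_dvd_mul_right (IsCoprime.pow_left ?_) e3
      rw [(irreducible_X_sub_C ζ).coprime_iff_not_dvd, dvd_iff_isRoot, IsRoot,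
        eval_map_algebraMap]
      exact hv
    · rw [rootMultiplicity_eq_zero]
      · exact Nat.zero_le _
      · rwa [IsRoot, eval_map_algebraMap]
  obtain ⟨u, hu⟩ := key
  refine ⟨u, x.denom, ?_, ?_⟩
  · rw [hu] at hnd
    exact (hnd.of_mul_left_left).symm
  · rw [← hu, RatFunc.num_div_denom]

end Local

/-! ### Nonvanishing of `1 - c q^a` for `a ≠ 0`. -/

section Transcendence

variable {K : Type*} [Field K]

lemma one_sub_C_mul_X_zpow_ne_zero {c : K} {a : ℤ} (ha : a ≠ 0) :
    1 - RatFunc.C c * (RatFunc.X : RatFunc K) ^ a ≠ 0 := by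
  intro h
  have key : ∀ (b : K) (k : ℕ), k ≠ 0 → (RatFunc.X : RatFunc K) ^ k ≠ RatFunc.C b := by
    intro b k hk h
    rw [← RatFunc.algebraMap_X, ← RatFunc.algebraMap_C, ← map_pow] at h
    have := congrArg natDegree (RatFunc.algebraMap_injective K h)
    simp at this
    exact hk this
  have hX : (RatFunc.X : RatFunc K) ≠ 0 := RatFunc.X_ne_zero
  rw [sub_eq_zero] at h
  obtain ⟨k, rfl | rfl⟩ := a.eq_nat_or_neg
  · refine key c⁻¹ k (by simpa using ha) ?_
    rw [map_inv₀]
    exact eq_inv_of_mul_eq_one_right (by rw [← zpow_natCast, ← h])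
  · refine key c k (by simpa using ha) ?_
    rw [zpow_neg, zpow_natCast] at h
    rw [← div_eq_mul_inv, eq_comm, div_eq_one_iff_eq (pow_ne_zero _ hX)] at h
    exact h.symm

lemma one_sub_X_zpow_ne_zero {a : ℤ} (ha : a ≠ 0) :
    1 - (RatFunc.X : RatFunc K) ^ a ≠ 0 := by
  simpa using one_sub_C_mul_X_zpow_ne_zero (K := K) (c := 1) ha

end Transcendence

/-! ### Orders of q-shifted factorials at roots of unity. -/

section Order

variable {K L : Type*} [Field K] [Field L] [Algebra K L]
  {ζ : L} {m n d : ℕ}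

/-- Both factors vanish simply at `ζ`: after division by `1 - q^m` they become geometric sums, which
count their terms at `ζ`. Thus `1 - q^n` serves as a uniform local parameter. -/
lemma Red.one_sub_zpow_div [CharZero L] (hζ : IsPrimitiveRoot ζ m) (hm : 0 < m) (hn : 0 < n) (hmn : m ∣ n)
    {a : ℤ} (ha : (m : ℤ) ∣ a) :
    Red ζ ((1 - (RatFunc.X : RatFunc K) ^ a) / (1 - RatFunc.X ^ n)) (a / n) := by
  set q : RatFunc K := RatFunc.X
  have hq : q ≠ 0 := RatFunc.X_ne_zero
  have hζ0 : ζ ≠ 0 := hζ.ne_zero hm.ne'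
  have hg : ∀ b : ℕ, Red ζ (∑ i ∈ Finset.range b, (q ^ m) ^ i) b := by
    intro b
    have : (b : L) = ∑ i ∈ Finset.range b, (ζ ^ m) ^ i := by simp [hζ.pow_eq_one]
    rw [this]
    exact Red.sum _ fun i _ => (Red.var.pow m).pow i
  have h1 : 1 - q ^ m ≠ 0 := by
    simpa using one_sub_X_zpow_ne_zero (K := K) (a := m) (by exact_mod_cast hm.ne')
  have hm0 : (m : L) ≠ 0 := by exact_mod_cast hm.ne'
  have hpos : ∀ b : ℕ, Red ζ ((1 - q ^ (m * b)) / (1 - q ^ n)) ((m * b : ℕ) / n : L) := by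
    intro b
    obtain ⟨e, rfl⟩ := hmn
    have he : e ≠ 0 := by rintro rfl; simp at hn
    have h2 : ((e : ℕ) : L) ≠ 0 := by exact_mod_cast he
    have h3 := (hg b).div (hg e) h2
    have h4 : ∀ b : ℕ, 1 - q ^ (m * b) = (1 - q ^ m) * ∑ i ∈ Finset.range b, (q ^ m) ^ i := by
      intro b; rw [mul_neg_geom_sum, pow_mul]
    rw [h4, h4, mul_div_mul_left _ _ h1]
    push_cast
    rwa [mul_div_mul_left _ _ hm0]
  obtain ⟨b, rfl⟩ := ha
  obtain ⟨b, rfl | rfl⟩ := b.eq_nat_or_neg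
  · have := hpos b
    rw [← zpow_natCast q (m * b)] at this
    push_cast at this ⊢
    exact this
  · have h5 := ((Red.var.zpow (K := K) hζ0 ((m : ℤ) * -b)).neg).mul (hpos b)
    have h6 : ζ ^ ((m : ℤ) * -b) = 1 := by
      rw [zpow_mul, zpow_natCast, hζ.pow_eq_one, one_zpow]
    rw [h6] at h5
    have h7 : 1 - q ^ ((m : ℤ) * -b) = -q ^ ((m : ℤ) * -b) * (1 - q ^ (m * b)) := by
      rw [mul_neg, zpow_neg]
      have : q ^ ((m : ℤ) * b) = q ^ (m * b) := by rw [← zpow_natCast]; push_cast; rfl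
      rw [this]
      field_simp
      ring
    rw [h7, mul_div_assoc]
    convert h5 using 1
    push_cast
    ring

lemma IsPrimitiveRoot.one_sub_zpow_ne_zero (hζ : IsPrimitiveRoot ζ m) {a : ℤ}
    (ha : ¬ (m : ℤ) ∣ a) : 1 - ζ ^ a ≠ 0 := by
  intro h
  exact ha ((hζ.zpow_eq_one_iff_dvd a).1 (sub_eq_zero.1 h).symm)

lemma modEq_of_dvd_add_mul (hdm : Nat.Coprime d m) {a : ℤ} {t : ℕ} (ht : (m : ℤ) ∣ a + d * t)
    (j : ℕ) : (m : ℤ) ∣ a + d * j ↔ j ≡ t [MOD m] := by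
  rw [Nat.modEq_iff_dvd]
  have h1 : a + d * (j : ℤ) = (a + d * t) - d * (t - j) := by ring
  rw [h1, dvd_sub_right ht]
  refine ⟨fun h => ?_, fun h => h.mul_left _⟩
  exact IsCoprime.dvd_of_dvd_mul_left (Nat.isCoprime_iff_coprime.2 hdm.symm) h

/-- The order of vanishing of `(q ^ a; q ^ d)_k` at a root of unity of order `m`. -/
lemma red_qPoch_div [CharZero L] (hζ : IsPrimitiveRoot ζ m) (hm : 0 < m) (hn : 0 < n) (hmn : m ∣ n)
    (hdm : Nat.Coprime d m) {a : ℤ} {t : ℕ} (ht : (m : ℤ) ∣ a + d * t) (k : ℕ) :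
    ∃ y, Red ζ (qPoch ((RatFunc.X : RatFunc K) ^ a) (RatFunc.X ^ d) k /
      (1 - RatFunc.X ^ n) ^ Nat.count (· ≡ t [MOD m]) k) y ∧
      ((∀ j < k, a + d * j ≠ 0) → y ≠ 0) := by
  have hq : (RatFunc.X : RatFunc K) ≠ 0 := RatFunc.X_ne_zero
  have hζ0 : ζ ≠ 0 := hζ.ne_zero hm.ne'
  have hfac : ∀ j : ℕ, (1 - (RatFunc.X : RatFunc K) ^ a * (RatFunc.X ^ d) ^ j) =
      1 - RatFunc.X ^ (a + d * j) := by
    intro j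
    rw [zpow_add₀ hq, zpow_mul, zpow_natCast, zpow_natCast]
  induction k with
  | zero => exact ⟨1, by simpa using Red.one, by simp⟩
  | succ k ih =>
    obtain ⟨y, hy, hy0⟩ := ih
    rw [qPoch_succ, hfac, Nat.count_succ]
    by_cases h : k ≡ t [MOD m]
    · rw [if_pos h, pow_succ, mul_div_mul_comm]
      refine ⟨_, hy.mul (Red.one_sub_zpow_div hζ hm hn hmn ((modEq_of_dvd_add_mul hdm ht k).2 h)),
        fun hj => mul_ne_zero (hy0 fun j hj' => hj j (by omega)) (div_ne_zero ?_ ?_)⟩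
      · exact_mod_cast hj k (by omega)
      · exact_mod_cast hn.ne'
    · rw [if_neg h, add_zero, mul_div_right_comm]
      refine ⟨_, hy.mul (Red.one.sub (Red.var.zpow hζ0 _)),
        fun hj => mul_ne_zero (hy0 fun j hj' => hj j (by omega)) ?_⟩
      exact hζ.one_sub_zpow_ne_zero fun hd => h ((modEq_of_dvd_add_mul hdm ht k).1 hd)

lemma van_qPoch_div [CharZero L] (hζ : IsPrimitiveRoot ζ m) (hm : 0 < m) (hn : 0 < n) (hmn : m ∣ n)
    (hdm : Nat.Coprime d m) {a : ℤ} {t : ℕ} (ht : (m : ℤ) ∣ a + d * t) (k : ℕ) :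
    Van ζ 0 (qPoch ((RatFunc.X : RatFunc K) ^ a) (RatFunc.X ^ d) k /
      (1 - RatFunc.X ^ n) ^ (k / m + if t % m < k % m then 1 else 0)) := by
  obtain ⟨y, hy, -⟩ := red_qPoch_div (K := K) hζ hm hn hmn hdm ht k
  rw [Nat.count_modEq_card _ hm] at hy
  exact Van.of_red hy

lemma one_sub_X_pow_ne_zero (hn : 0 < n) : 1 - (RatFunc.X : RatFunc K) ^ n ≠ 0 := by
  simpa using one_sub_X_zpow_ne_zero (K := K) (a := n) (by exact_mod_cast hn.ne')

lemma Van.one_sub_X_pow (h : ζ ^ n = 1) : Van ζ 1 (1 - (RatFunc.X : RatFunc K) ^ n) := by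
  refine Van.of_red_zero ?_
  have := (Red.one.sub (Red.var.pow n) : Red ζ (1 - (RatFunc.X : RatFunc K) ^ n) (1 - ζ ^ n))
  rwa [h, sub_self] at this

/-- Among the exponents `d (j + 1)`, those divisible by `m` have `j ≡ m - 1`, the latest possible
residue, so the order is exactly `k / m`, the least possible for a progression of step `d`. -/
lemma van_inv_qPoch_mul [CharZero L] (hζ : IsPrimitiveRoot ζ m) (hm : 0 < m) (hn : 0 < n) (hmn : m ∣ n)
    (hd : 0 < d) (hdm : Nat.Coprime d m) (k : ℕ) :
    Van ζ 0 ((1 - RatFunc.X ^ n) ^ (k / m) /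
      qPoch ((RatFunc.X : RatFunc K) ^ d) (RatFunc.X ^ d) k) := by
  obtain ⟨y, hy, hy0⟩ := red_qPoch_div (K := K) (a := d) (t := m - 1) hζ hm hn hmn hdm
    ⟨d, by push_cast [Nat.cast_sub (show 1 ≤ m by omega)]; ring⟩ k
  rw [Nat.count_modEq_card _ hm, if_neg, add_zero, zpow_natCast] at hy
  · simpa using Van.of_red (hy.inv (hy0 fun j _ => by positivity))
  · have := Nat.mod_lt k hm
    rw [Nat.mod_eq_of_lt (show m - 1 < m by omega)]
    omega

/-- The quotient `(q ^ a; q ^ d)_k / (q ^ d; q ^ d)_k` has no pole at a root of unity. -/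
lemma van_qPoch_div_qPoch [CharZero L] (hζ : IsPrimitiveRoot ζ m) (hm : 0 < m) (hn : 0 < n) (hmn : m ∣ n)
    (hd : 0 < d) (hdm : Nat.Coprime d m) {a : ℤ} {t : ℕ} (ht : (m : ℤ) ∣ a + d * t) (k : ℕ) :
    Van ζ 0 (qPoch ((RatFunc.X : RatFunc K) ^ a) (RatFunc.X ^ d) k /
      qPoch ((RatFunc.X : RatFunc K) ^ d) (RatFunc.X ^ d) k) := by
  have h1 := van_qPoch_div (K := K) hζ hm hn hmn hdm ht k
  have h2 := van_inv_qPoch_mul (K := K) hζ hm hn hmn hd hdm k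
  have h3 := (Van.one_sub_X_pow (K := K) ((hζ.pow_eq_one_iff_dvd n).2 hmn)).mono zero_le_one
  have hω := one_sub_X_pow_ne_zero (K := K) hn
  have h4 := (h1.mul_left h2).mul_left (h3.pow (if t % m < k % m then 1 else 0))
  rw [zero_mul] at h4
  convert h4 using 1
  rw [pow_add]
  field_simp

end Order

/-! ### Antisymmetry of terminating very-well-poised terms. -/

section Antisymmetry

variable {F : Type*} [Field F]

lemma qPoch_mul_reverse {p : F} (hp : p ≠ 0) {a : F} (ha : a ≠ 0) (i j : ℕ) :
    qPoch (a * (p ^ (i + j))⁻¹) p j * qPoch (p / a) p i =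
      (∏ l ∈ Finset.range j, (-(a * p ^ l / p ^ (i + j)))) * qPoch (p / a) p (i + j) := by
  have h : qPoch (a * (p ^ (i + j))⁻¹) p j =
      (∏ l ∈ Finset.range j, (-(a * p ^ l / p ^ (i + j)))) * qPoch (p / a * p ^ i) p j := by
    rw [qPoch, qPoch, ← Finset.prod_range_reflect (fun l => 1 - p / a * p ^ i * p ^ l),
      ← Finset.prod_mul_distrib]
    refine Finset.prod_congr rfl fun l hl => ?_
    obtain ⟨s, rfl⟩ : ∃ s, j = l + 1 + s := ⟨j - (l + 1), by
      have := Finset.mem_range.1 hl; omega⟩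
    rw [show l + 1 + s - 1 - l = s by omega]
    have h1 : p ^ l ≠ 0 := pow_ne_zero _ hp
    have h2 : p ^ s ≠ 0 := pow_ne_zero _ hp
    have h3 : p ^ i ≠ 0 := pow_ne_zero _ hp
    rw [pow_add, pow_add, pow_add, pow_one]
    field_simp
    ring
  rw [h, qPoch_add]
  ring

/-- The monomials left over by reversing the numerators combine with the argument of the series into
a pure power of `p`, free of `c`. -/
lemma wp_weight {p c : F} (hp : p ≠ 0) (hc : c ≠ 0) (t j : ℕ) :
    ((∏ l ∈ Finset.range j, (-(1 * p ^ l / p ^ t))) ^ 5 *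
      (∏ l ∈ Finset.range j, (-(c * p ^ l / p ^ t))) * (p ^ 2 * (p ^ t) ^ 3 / c) ^ j) *
      (p ^ t) ^ (3 * j) * p ^ j = p ^ (3 * j ^ 2) := by
  induction j with
  | zero => simp
  | succ j ih =>
    rw [Finset.prod_range_succ, Finset.prod_range_succ]
    have e1 : p ^ (3 * (j + 1) ^ 2) = p ^ (3 * j ^ 2) * ((p ^ j) ^ 6 * p ^ 3) := by
      rw [← pow_mul, ← pow_add, ← pow_add]; congr 1; ring
    rw [e1, ← ih]
    have h1 : p ^ t ≠ 0 := pow_ne_zero _ hp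
    rw [pow_succ _ j, pow_succ _ j, show 3 * (j + 1) = 3 * j + 3 by ring, pow_add _ (3 * j)]
    generalize (p ^ t) ^ (3 * j) = x
    generalize p ^ t = y at *
    generalize p ^ j = z
    generalize (p ^ 2 * y ^ 3 / c) ^ j = w
    field_simp

/-- The terms of a terminating very-well-poised series, with all parameters equal to `p ^ (-t)`
but one that equals `c p ^ (-t)`. -/
def wpSymmTerm (p c : F) (t k : ℕ) : F :=
  (1 - (p ^ k) ^ 2 * (p ^ t)⁻¹) *
    (qPoch (p ^ t)⁻¹ p k ^ 5 * qPoch (c * (p ^ t)⁻¹) p k / (qPoch p p k ^ 5 * qPoch (p / c) p k)) *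
    (p ^ 2 * (p ^ t) ^ 3 / c) ^ k

/-- With `i + j = t` the term is a product of binomial-type quotients symmetric in `i, j` and the
factor `p^(-j) - p^(-i)`, so the antisymmetry is visible. -/
lemma wpSymmTerm_eq {p c : F} (hp : p ≠ 0) (hc : c ≠ 0) (i j : ℕ)
    (h1 : qPoch p p (i + j) ≠ 0) (h2 : qPoch (p / c) p (i + j) ≠ 0) :
    wpSymmTerm p c (i + j) j = ((p ^ j)⁻¹ - (p ^ i)⁻¹) * (p ^ (3 * (i * j)))⁻¹ *
      ((qPoch p p (i + j) / (qPoch p p i * qPoch p p j)) ^ 5 *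
        (qPoch (p / c) p (i + j) / (qPoch (p / c) p i * qPoch (p / c) p j))) := by
  have r1 := qPoch_mul_reverse hp one_ne_zero i j
  have r2 := qPoch_mul_reverse hp hc i j
  rw [one_mul, div_one] at r1
  have w := wp_weight hp hc (i + j) j
  have g1 := qPoch_ne_zero_of_le h1 (Nat.le_add_right i j)
  have g2 := qPoch_ne_zero_of_le h2 (Nat.le_add_right i j)
  have f1 := qPoch_ne_zero_of_le h1 (Nat.le_add_left j i)
  have f2 := qPoch_ne_zero_of_le h2 (Nat.le_add_left j i)
  rw [← eq_div_iff g1] at r1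
  rw [← eq_div_iff g2] at r2
  have hi : p ^ i ≠ 0 := pow_ne_zero _ hp
  have hj : p ^ j ≠ 0 := pow_ne_zero _ hp
  have hij : p ^ (3 * (i * j)) ≠ 0 := pow_ne_zero _ hp
  have hjj : p ^ (3 * j ^ 2) ≠ 0 := pow_ne_zero _ hp
  have e1 : (p ^ (i + j)) ^ (3 * j) = p ^ (3 * (i * j)) * p ^ (3 * j ^ 2) := by
    rw [← pow_mul, ← pow_add]; congr 1; ring
  rw [e1] at w
  have w' : (∏ l ∈ Finset.range j, (-(1 * p ^ l / p ^ (i + j)))) ^ 5 *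
      (∏ l ∈ Finset.range j, (-(c * p ^ l / p ^ (i + j)))) *
        (p ^ 2 * (p ^ (i + j)) ^ 3 / c) ^ j = (p ^ (3 * (i * j)))⁻¹ * (p ^ j)⁻¹ := by
    rw [← mul_inv]
    apply eq_inv_of_mul_eq_one_left
    apply mul_right_cancel₀ hjj
    linear_combination w
  rw [wpSymmTerm, r1, r2]
  have e2 : ((p ^ j)⁻¹ - (p ^ i)⁻¹) = (1 - (p ^ j) ^ 2 * (p ^ (i + j))⁻¹) * (p ^ j)⁻¹ := by
    rw [pow_add]; field_simp
  rw [e2]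
  generalize (∏ l ∈ Finset.range j, (-(1 * p ^ l / p ^ (i + j)))) = W1 at *
  generalize (∏ l ∈ Finset.range j, (-(c * p ^ l / p ^ (i + j)))) = W2 at *
  generalize (p ^ 2 * (p ^ (i + j)) ^ 3 / c) ^ j = W3 at *
  calc _ = (1 - (p ^ j) ^ 2 * (p ^ (i + j))⁻¹) * (W1 ^ 5 * W2 * W3) *
      ((qPoch p p (i + j) / (qPoch p p i * qPoch p p j)) ^ 5 *
        (qPoch (p / c) p (i + j) / (qPoch (p / c) p i * qPoch (p / c) p j))) := by ring
    _ = _ := by rw [w']; ring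

lemma wpSymmTerm_antisymm {p c : F} (hp : p ≠ 0) (hc : c ≠ 0) (i j : ℕ)
    (h1 : qPoch p p (i + j) ≠ 0) (h2 : qPoch (p / c) p (i + j) ≠ 0) :
    wpSymmTerm p c (i + j) i = -wpSymmTerm p c (i + j) j := by
  rw [wpSymmTerm_eq hp hc i j h1 h2]
  rw [add_comm i j] at h1 h2 ⊢
  rw [wpSymmTerm_eq hp hc j i h1 h2, mul_comm j i]
  ring

/-- A function that is antisymmetric under `k ↦ t - k` sums to zero. -/
lemma sum_eq_zero_of_antisymm [CharZero F] {t : ℕ} {f : ℕ → F}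
    (h : ∀ i j, i + j = t → f i = -f j) : ∑ k ∈ Finset.range (t + 1), f k = 0 := by
  have h1 := Finset.sum_range_reflect f (t + 1)
  have h2 : ∑ j ∈ Finset.range (t + 1), f (t + 1 - 1 - j) = -∑ j ∈ Finset.range (t + 1), f j := by
    rw [← Finset.sum_neg_distrib]
    refine Finset.sum_congr rfl fun j hj => h _ _ ?_
    have := Finset.mem_range.1 hj
    omega
  rw [h2] at h1
  exact self_eq_neg.1 h1.symm

/-- The factor of the summand of `lhsSum` other than the `q`-integer. -/
def lhsFactor (q c : F) (d : ℕ) (r : ℤ) (k : ℕ) : F :=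
  qPoch (q ^ r) (q ^ d) k ^ 5 * qPoch (c * q ^ r) (q ^ d) k /
      (qPoch (q ^ d) (q ^ d) k ^ 5 * qPoch (q ^ d / c) (q ^ d) k) *
    (q ^ (2 * (d : ℤ) - 3 * r) / c) ^ k

lemma lhsSum_eq (q c : F) (d : ℕ) (r : ℤ) (M : ℕ) :
    lhsSum q c d r M =
      ∑ k ∈ Finset.range (M + 1), qInt q (2 * d * k + r) * lhsFactor q c d r k := by
  rw [lhsSum]
  exact Finset.sum_congr rfl fun k _ => by rw [lhsFactor]; ring

lemma lhsTerm_eq_wpSymmTerm {q : F} (hq : q ≠ 0) (c : F) {d t : ℕ} {r : ℤ}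
    (hr : q ^ r = ((q ^ d) ^ t)⁻¹) (k : ℕ) :
    qInt q (2 * d * k + r) * lhsFactor q c d r k = wpSymmTerm (q ^ d) c t k / (1 - q) := by
  have e1 : q ^ (2 * (d : ℤ) * k + r) = ((q ^ d) ^ k) ^ 2 * ((q ^ d) ^ t)⁻¹ := by
    have : q ^ (2 * (d : ℤ) * k) = ((q ^ d) ^ k) ^ 2 := by
      rw [← pow_mul, ← pow_mul, ← zpow_natCast]
      congr 1; push_cast; ring
    rw [zpow_add₀ hq, hr, this]
  have e2 : q ^ (2 * (d : ℤ) - 3 * r) = (q ^ d) ^ 2 * ((q ^ d) ^ t) ^ 3 := by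
    have h2 : q ^ (2 * (d : ℤ)) = (q ^ d) ^ 2 := by
      rw [← pow_mul, ← zpow_natCast]
      congr 1; push_cast; ring
    have h3 : q ^ (3 * r) = (q ^ r) ^ 3 := by
      rw [← zpow_natCast (q ^ r), ← zpow_mul]
      congr 1; push_cast; ring
    rw [zpow_sub₀ hq, h2, h3, hr, inv_pow, div_inv_eq_mul]
  rw [qInt, lhsFactor, wpSymmTerm, e1, e2, hr]
  ring

lemma lhsTerm_antisymm {q c : F} (hq : q ≠ 0) (hc : c ≠ 0) {d t : ℕ} {r : ℤ}
    (hr : q ^ r = ((q ^ d) ^ t)⁻¹) (h1 : qPoch (q ^ d) (q ^ d) t ≠ 0)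
    (h2 : qPoch (q ^ d / c) (q ^ d) t ≠ 0) {i j : ℕ} (hij : i + j = t) :
    qInt q (2 * d * i + r) * lhsFactor q c d r i =
      -(qInt q (2 * d * j + r) * lhsFactor q c d r j) := by
  subst hij
  rw [lhsTerm_eq_wpSymmTerm hq c hr, lhsTerm_eq_wpSymmTerm hq c hr,
    wpSymmTerm_antisymm (pow_ne_zero _ hq) hc i j h1 h2, neg_div]

lemma lhsFactor_add {q : F} (c : F) (d : ℕ) (r : ℤ) (k j : ℕ) :
    lhsFactor q c d r (k + j) = lhsFactor q c d r k *
      (qPoch (q ^ r * (q ^ d) ^ k) (q ^ d) j ^ 5 * qPoch (c * q ^ r * (q ^ d) ^ k) (q ^ d) j /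
        (qPoch (q ^ d * (q ^ d) ^ k) (q ^ d) j ^ 5 * qPoch (q ^ d / c * (q ^ d) ^ k) (q ^ d) j) *
      (q ^ (2 * (d : ℤ) - 3 * r) / c) ^ j) := by
  simp only [lhsFactor, qPoch_add]
  ring

lemma sum_range_mul_add (f : ℕ → F) (m s J : ℕ) :
    ∑ k ∈ Finset.range (s * m + J), f k =
      ∑ l ∈ Finset.range s, ∑ j ∈ Finset.range m, f (l * m + j) +
        ∑ j ∈ Finset.range J, f (s * m + j) := by
  rw [Finset.sum_range_add]
  congr 1
  induction s with
  | zero => simp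
  | succ s ih => rw [Nat.succ_mul, Finset.sum_range_add, ih, Finset.sum_range_succ]

end Antisymmetry

/-! ### The left side at an arbitrary nontrivial root of unity. -/

section LeftSide

variable {K L : Type*} [Field K] [Field L] [Algebra K L] {ζ : L} {m n d N : ℕ} {r : ℤ} {c : K}

lemma qPoch_root_ne_zero (hζ : IsPrimitiveRoot ζ m) (hdm : Nat.Coprime d m) {j : ℕ} (hj : j < m) :
    qPoch (ζ ^ d) (ζ ^ d) j ≠ 0 := by
  rw [qPoch_ne_zero_iff]
  intro i hi h
  rw [← pow_succ'] at h
  have h1 := hζ.pow_of_coprime d hdm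
  have h2 := (h1.pow_eq_one_iff_dvd _).1 (sub_eq_zero.1 h).symm
  have := Nat.le_of_dvd (by omega) h2
  omega

lemma qPoch_root_div_ne_zero_of_pow_ne_one (h : ζ ^ n = 1) (hc : c ≠ 0) (hcn : c ^ n ≠ 1) (k : ℕ) :
    qPoch (ζ ^ d / algebraMap K L c) (ζ ^ d) k ≠ 0 := by
  rw [qPoch_ne_zero_iff]
  intro i _ h1
  have hc' : algebraMap K L c ≠ 0 := by simpa using hc
  have h2 : algebraMap K L c = ζ ^ (d * (i + 1)) := by
    rw [sub_eq_zero, eq_comm, div_mul_eq_mul_div, div_eq_iff hc', one_mul, ← pow_succ',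
      ← pow_mul] at h1
    exact h1.symm
  apply hcn
  apply (algebraMap K L).injective
  rw [map_pow, h2, ← pow_mul, mul_comm, pow_mul, h]
  simp

/-- Either `c = 1`, and the symbol is `(ζ^d; ζ^d)_j` with `j < m`, or `c^n ≠ 1`, and `c` is not a
power of `ζ` at all. -/
lemma qPoch_root_div_ne_zero (hζ : IsPrimitiveRoot ζ m) (hmn : m ∣ n) (hdm : Nat.Coprime d m)
    (hc : c ≠ 0) (hc_root : c ^ n = 1 → c = 1) {j : ℕ} (hj : j < m) :
    qPoch (ζ ^ d / algebraMap K L c) (ζ ^ d) j ≠ 0 := by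
  by_cases h : c ^ n = 1
  · rw [hc_root h, map_one, div_one]
    exact qPoch_root_ne_zero hζ hdm hj
  · exact qPoch_root_div_ne_zero_of_pow_ne_one ((hζ.pow_eq_one_iff_dvd n).2 hmn) hc h j

lemma van_qPoch_C (hζ0 : ζ ≠ 0) (c : K) (a : ℤ) (k : ℕ) :
    Van ζ 0 (qPoch (RatFunc.C c * RatFunc.X ^ a) (RatFunc.X ^ d) k) :=
  Van.of_red (Red.qPoch ((Red.const c).mul (Red.var.zpow hζ0 a)) (Red.var.pow d) k)

lemma red_qPoch_div_C (hc : c ≠ 0) (k : ℕ) :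
    Red ζ (qPoch ((RatFunc.X : RatFunc K) ^ d / RatFunc.C c) (RatFunc.X ^ d) k)
      (qPoch (ζ ^ d / algebraMap K L c) (ζ ^ d) k) :=
  Red.qPoch ((Red.var.pow d).div (Red.const c) (by simpa using hc)) (Red.var.pow d) k

lemma van_qPoch_C_div [CharZero L] (hζ : IsPrimitiveRoot ζ m) (hm : 0 < m) (hn : 0 < n)
    (hmn : m ∣ n) (hd : 0 < d) (hdm : Nat.Coprime d m) (hc : c ≠ 0) (hc_root : c ^ n = 1 → c = 1)
    {a : ℤ} {t : ℕ} (ht : (m : ℤ) ∣ a + d * t) (k : ℕ) :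
    Van ζ 0 (qPoch (RatFunc.C c * RatFunc.X ^ a) (RatFunc.X ^ d) k /
      qPoch ((RatFunc.X : RatFunc K) ^ d / RatFunc.C c) (RatFunc.X ^ d) k) := by
  by_cases h : c ^ n = 1
  · rw [hc_root h, map_one, div_one, one_mul]
    exact van_qPoch_div_qPoch hζ hm hn hmn hd hdm ht k
  · have h1 := (red_qPoch_div_C (ζ := ζ) (d := d) hc k).inv
      (qPoch_root_div_ne_zero_of_pow_ne_one ((hζ.pow_eq_one_iff_dvd n).2 hmn) hc h k)
    rw [div_eq_mul_inv]
    exact (van_qPoch_C (hζ.ne_zero hm.ne') c a k).mul_left (Van.of_red h1)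

/-- At `ζ` the parameter `q^r` becomes a negative power of the base, so the reduced series
terminates at index `N % m`. -/
lemma zpow_root_eq (hζ : IsPrimitiveRoot ζ m) (hm : 0 < m) (hmn : m ∣ n)
    (hr : r + d * N = n) : ζ ^ r = ((ζ ^ d) ^ (N % m))⁻¹ := by
  have hζ0 : ζ ≠ 0 := hζ.ne_zero hm.ne'
  have h1 : (ζ ^ d) ^ (N % m) = (ζ ^ d) ^ N := by
    conv_rhs => rw [← Nat.mod_add_div N m]
    rw [pow_add, pow_mul _ m, ← pow_mul ζ d m, mul_comm d m, pow_mul ζ m d, hζ.pow_eq_one]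
    simp
  apply eq_inv_of_mul_eq_one_left
  rw [h1, ← pow_mul, ← zpow_natCast, ← zpow_add₀ hζ0]
  push_cast
  rw [hr, zpow_natCast]
  exact (hζ.pow_eq_one_iff_dvd n).2 hmn

lemma dvd_add_mul_self (hmn : m ∣ n) (hr : r + d * N = n) : (m : ℤ) ∣ r + d * N := by
  rw [hr]; exact_mod_cast hmn

lemma van_lhsFactor [CharZero L] (hζ : IsPrimitiveRoot ζ m) (hm : 0 < m) (hn : 0 < n)
    (hmn : m ∣ n) (hd : 0 < d) (hdm : Nat.Coprime d m) (hr : r + d * N = n)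
    (hc : c ≠ 0) (hc_root : c ^ n = 1 → c = 1) (k : ℕ) :
    Van ζ 0 (lhsFactor RatFunc.X (RatFunc.C c) d r k) := by
  have h1 := van_qPoch_div_qPoch (K := K) hζ hm hn hmn hd hdm (dvd_add_mul_self hmn hr) k
  have h2 := van_qPoch_C_div hζ hm hn hmn hd hdm hc hc_root (dvd_add_mul_self hmn hr) k
  have h3 : Van ζ 0 ((RatFunc.X : RatFunc K) ^ (2 * (d : ℤ) - 3 * r) / RatFunc.C c) :=
    Van.of_red ((Red.var.zpow (hζ.ne_zero hm.ne') _).div (Red.const c) (by simpa using hc))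
  have h4 := ((h1.pow 5).mul (h2)).mul (h3.pow k)
  simp only [zero_mul, add_zero] at h4
  convert h4 using 1
  rw [lhsFactor]
  ring

/-- Since `(q^d)^(l m)` reduces to `1`, the symbols shifted by `l m` reduce to the unshifted ones;
`σ` is the value of the factor at index `l m`. -/
lemma red_lhsFactor_add [CharZero L] (hζ : IsPrimitiveRoot ζ m) (hm : 0 < m) (hn : 0 < n)
    (hmn : m ∣ n) (hd : 0 < d) (hdm : Nat.Coprime d m) (hr : r + d * N = n)
    (hc : c ≠ 0) (hc_root : c ^ n = 1 → c = 1) (l : ℕ) :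
    ∃ σ, ∀ j < m, Red ζ (lhsFactor RatFunc.X (RatFunc.C c) d r (l * m + j))
      (σ * lhsFactor ζ (algebraMap K L c) d r j) := by
  have hζ0 : ζ ≠ 0 := hζ.ne_zero hm.ne'
  obtain ⟨σ, hσ⟩ := (van_lhsFactor hζ hm hn hmn hd hdm hr hc hc_root (l * m)).exists_red
  refine ⟨σ, fun j hj => ?_⟩
  rw [lhsFactor_add, lhsFactor]
  have hp : Red ζ (((RatFunc.X : RatFunc K) ^ d) ^ (l * m)) 1 := by
    have := ((Red.var (K := K) (ζ := ζ)).pow d).pow (l * m)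
    have h1 : (ζ ^ d) ^ (l * m) = 1 := by
      rw [← pow_mul, show d * (l * m) = m * (d * l) by ring, pow_mul, hζ.pow_eq_one, one_pow]
    rwa [h1] at this
  have hq : Red ζ ((RatFunc.X : RatFunc K) ^ d) (ζ ^ d) := Red.var.pow d
  have hC : Red ζ (RatFunc.C c) (algebraMap K L c) := Red.const c
  have hC0 : algebraMap K L c ≠ 0 := by simpa using hc
  have hr' : Red ζ ((RatFunc.X : RatFunc K) ^ r) (ζ ^ r) := Red.var.zpow hζ0 r
  have e1 := (hr'.mul hp).qPoch hq j
  have e2 := ((hC.mul hr').mul hp).qPoch hq j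
  have e3 := (hq.mul hp).qPoch hq j
  have e4 := ((hq.div hC hC0).mul hp).qPoch hq j
  rw [mul_one] at e1 e2 e3 e4
  refine hσ.mul ((((e1.pow 5).mul e2).div ((e3.pow 5).mul e4) ?_).mul
    (((Red.var.zpow hζ0 _).div hC hC0).pow j))
  exact mul_ne_zero (pow_ne_zero _ (qPoch_root_ne_zero hζ hdm hj))
    (qPoch_root_div_ne_zero hζ hmn hdm hc hc_root hj)

lemma lhsFactor_root_eq_zero (hζ : IsPrimitiveRoot ζ m) (hm : 0 < m) (hmn : m ∣ n)
    (hr : r + d * N = n) (c : L) {j : ℕ} (hj : N % m < j) : lhsFactor ζ c d r j = 0 := by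
  have hζ0 : ζ ≠ 0 := hζ.ne_zero hm.ne'
  have : qPoch (ζ ^ r) (ζ ^ d) j = 0 := by
    rw [zpow_root_eq hζ hm hmn hr]
    exact qPoch_inv_pow_eq_zero (pow_ne_zero _ hζ0) hj
  simp [lhsFactor, this]

lemma lhsTerm_root_antisymm (hζ : IsPrimitiveRoot ζ m) (hm : 0 < m)
    (hmn : m ∣ n) (hdm : Nat.Coprime d m) (hr : r + d * N = n)
    (hc : c ≠ 0) (hc_root : c ^ n = 1 → c = 1) {i j : ℕ} (hij : i + j = N % m) :
    qInt ζ (2 * d * i + r) * lhsFactor ζ (algebraMap K L c) d r i =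
      -(qInt ζ (2 * d * j + r) * lhsFactor ζ (algebraMap K L c) d r j) :=
  lhsTerm_antisymm (hζ.ne_zero hm.ne') (by simpa using hc) (zpow_root_eq hζ hm hmn hr)
    (qPoch_root_ne_zero hζ hdm (Nat.mod_lt _ hm))
    (qPoch_root_div_ne_zero hζ hmn hdm hc hc_root (Nat.mod_lt _ hm)) hij

/-- The left-hand side vanishes at all nontrivial `n`-th roots of unity. -/
lemma van_lhsSum [CharZero L] (hζ : IsPrimitiveRoot ζ m) (hm : 1 < m) (hn : 0 < n)
    (hmn : m ∣ n) (hd : 0 < d) (hdm : Nat.Coprime d m) (hr : r + d * N = n)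
    (hc : c ≠ 0) (hc_root : c ^ n = 1 → c = 1) {M : ℕ} (hM : M = N ∨ M = n - 1) :
    Van ζ 1 (lhsSum RatFunc.X (RatFunc.C c) d r M) := by
  have hm0 : 0 < m := by omega
  have hζ0 : ζ ≠ 0 := hζ.ne_zero hm0.ne'
  have hζ1 : ζ ≠ 1 := hζ.ne_one hm
  -- A full block, or one cut just after `N % m`, vanishes at `ζ`: reduced terms beyond `N % m` are
  -- zero and the others cancel in pairs.
  have hblock : ∀ l J, J = m ∨ J = N % m + 1 → Van ζ 1 (∑ j ∈ Finset.range J,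
      qInt (RatFunc.X : RatFunc K) (2 * d * (l * m + j : ℕ) + r) *
        lhsFactor RatFunc.X (RatFunc.C c) d r (l * m + j)) := by
    intro l J hJ
    obtain ⟨σ, hσ⟩ := red_lhsFactor_add hζ hm0 hn hmn hd hdm hr hc hc_root l
    have hlt := Nat.mod_lt N hm0
    have h1 : Red ζ (∑ j ∈ Finset.range J,
      qInt (RatFunc.X : RatFunc K) (2 * d * (l * m + j : ℕ) + r) *
        lhsFactor RatFunc.X (RatFunc.C c) d r (l * m + j))
        (∑ j ∈ Finset.range J, qInt ζ (2 * d * (l * m + j : ℕ) + r) *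
          (σ * lhsFactor ζ (algebraMap K L c) d r j)) :=
      Red.sum _ fun j hj => (Red.qInt hζ0 hζ1 _).mul (hσ j (by
        have := Finset.mem_range.1 hj; omega))
    have h2 : ∀ j, qInt ζ (2 * d * (l * m + j : ℕ) + r) *
        (σ * lhsFactor ζ (algebraMap K L c) d r j) =
        σ * (qInt ζ (2 * d * j + r) * lhsFactor ζ (algebraMap K L c) d r j) := by
      intro j
      have : ζ ^ (2 * (d : ℤ) * (l * m + j : ℕ) + r) = ζ ^ (2 * (d : ℤ) * j + r) := by
        rw [show 2 * (d : ℤ) * (l * m + j : ℕ) + r = (m : ℤ) * (2 * d * l) + (2 * d * j + r) by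
          push_cast; ring, zpow_add₀ hζ0, zpow_mul, zpow_natCast, hζ.pow_eq_one, one_zpow, one_mul]
      rw [qInt, qInt, this]
      ring
    simp only [h2] at h1
    rw [← Finset.mul_sum] at h1
    have h3 : ∑ j ∈ Finset.range J,
        (qInt ζ (2 * d * j + r) * lhsFactor ζ (algebraMap K L c) d r j) = 0 := by
      rw [← Finset.sum_subset (Finset.range_subset_range.2 (show N % m + 1 ≤ J by omega))]
      · exact sum_eq_zero_of_antisymm fun i j hij =>
          lhsTerm_root_antisymm hζ hm0 hmn hdm hr hc hc_root hij
      · intro j _ hj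
        rw [lhsFactor_root_eq_zero hζ hm0 hmn hr _ (by simpa using hj), mul_zero]
    rw [h3, mul_zero] at h1
    exact Van.of_red_zero h1
  rw [lhsSum_eq]
  rcases hM with rfl | rfl
  -- Cutting at `N` leaves a last block of length `N % m + 1`; cutting at `n - 1` leaves only full
  -- blocks, as `m ∣ n`.
  · have e : M + 1 = M / m * m + (M % m + 1) := by
      have := Nat.div_add_mod' M m; omega
    rw [e, sum_range_mul_add]
    exact (Van.sum _ fun l _ => hblock l m (Or.inl rfl)).add (hblock _ _ (Or.inr rfl))
  · have e : n - 1 + 1 = n / m * m + 0 := by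
      rw [Nat.div_mul_cancel hmn]; omega
    rw [e, sum_range_mul_add]
    simpa using (Van.sum _ fun l _ => hblock l m (Or.inl rfl))

end LeftSide

/-! ### The right side at an arbitrary nontrivial root of unity. -/

section RightSide

/-- The coefficient of index `k` on the right-hand side, including the prefactor. -/
def rhsCoeff {F : Type*} [Field F] (q c : F) (n d : ℕ) (r : ℤ) (N k : ℕ) : F :=
  qInt q n * (c * q ^ r) ^ ((r - n) / (d : ℤ)) *
    (qPoch (c * q ^ (2 * r)) (q ^ d) N / qPoch (q ^ d / c) (q ^ d) N) *
    (qPoch (q ^ r) (q ^ d) k ^ 2 *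
          (qPoch (q ^ ((d : ℤ) - r)) (q ^ d) k * qPoch (c * q ^ r) (q ^ d) k) * q ^ (d * k) /
        (qPoch (q ^ d) (q ^ d) k ^ 3 * qPoch (c * q ^ (2 * r)) (q ^ d) k))

lemma rhsSum_eq {F : Type*} [Field F] (q c : F) (n d : ℕ) (r : ℤ) (N : ℕ) :
    rhsSum q c n d r N = ∑ k ∈ Finset.range (N + 1), rhsCoeff q c n d r N k *
      (1 - qInt q n ^ 2 * (2 - q ^ n) * harmSum q d r k) := by
  rw [rhsSum, Finset.mul_sum]
  exact Finset.sum_congr rfl fun k _ => by rw [rhsCoeff]; ring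

variable {K L : Type*} [Field K] [Field L] [Algebra K L] {ζ : L} {m n d N : ℕ} {r : ℤ} {c : K}

lemma van_qPoch_div_pow [CharZero L] (hζ : IsPrimitiveRoot ζ m) (hm : 0 < m) (hn : 0 < n)
    (hmn : m ∣ n) (hdm : Nat.Coprime d m) {a : ℤ} {t : ℕ} (ht : (m : ℤ) ∣ a + d * t) (k : ℕ) :
    Van ζ 0 (qPoch ((RatFunc.X : RatFunc K) ^ a) (RatFunc.X ^ d) k /
      (1 - RatFunc.X ^ n) ^ (k / m)) := by
  have h1 := van_qPoch_div (K := K) hζ hm hn hmn hdm ht k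
  have h3 := (Van.one_sub_X_pow (K := K) ((hζ.pow_eq_one_iff_dvd n).2 hmn)).mono zero_le_one
  have hω := one_sub_X_pow_ne_zero (K := K) hn
  have h4 := h1.mul_left (h3.pow (if t % m < k % m then 1 else 0))
  rw [zero_mul] at h4
  convert h4 using 1
  rw [pow_add]
  field_simp

lemma van_qInt (hζ0 : ζ ≠ 0) (hζ1 : ζ ≠ 1) (h : ζ ^ n = 1) :
    Van ζ 1 (qInt (RatFunc.X : RatFunc K) n) := by
  have := Red.qInt (K := K) hζ0 hζ1 n
  have e : qInt ζ n = 0 := by rw [qInt, zpow_natCast, h, sub_self, zero_div]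
  rw [e] at this
  exact Van.of_red_zero this

/-- The zero comes from `[n]`. The denominator `(cq^(2r))_k` is absorbed by `(cq^(2r))_N`, leaving
`(cq^(2r+dk))_(N-k)`; what remains has no pole. -/
lemma van_rhsCoeff [CharZero L] (hζ : IsPrimitiveRoot ζ m) (hm : 1 < m) (hn : 0 < n)
    (hmn : m ∣ n) (hd : 0 < d) (hdm : Nat.Coprime d m) (hr : r + d * N = n)
    (hc : c ≠ 0) (hc_root : c ^ n = 1 → c = 1)
    (hden : qPoch (RatFunc.C c * RatFunc.X ^ (2 * r)) ((RatFunc.X : RatFunc K) ^ d) N ≠ 0)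
    {k : ℕ} (hk : k ≤ N) :
    Van ζ 1 (rhsCoeff RatFunc.X (RatFunc.C c) n d r N k) := by
  have hm0 : 0 < m := by omega
  have hζ0 : ζ ≠ 0 := hζ.ne_zero hm0.ne'
  have hζ1 : ζ ≠ 1 := hζ.ne_one hm
  have hζn : ζ ^ n = 1 := (hζ.pow_eq_one_iff_dvd n).2 hmn
  have hX : (RatFunc.X : RatFunc K) ≠ 0 := RatFunc.X_ne_zero
  have hC0 : algebraMap K L c ≠ 0 := by simpa using hc
  have tr := dvd_add_mul_self hmn hr
  -- Modulo `m`, `r ≡ -d N`. The factor `m - 1` stands for `-1`, keeping the witnesses for the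
  -- residues `-(N + 1)` and, below, `2 N - k` natural numbers.
  have tdr : (m : ℤ) ∣ ((d : ℤ) - r) + d * ((m - 1) * (N + 1) : ℕ) := by
    obtain ⟨b, hb⟩ := tr
    refine ⟨d * (N + 1) - b, ?_⟩
    push_cast [Nat.cast_sub (show 1 ≤ m by omega)]
    linear_combination -hb
  have t2r : (m : ℤ) ∣ (2 * r + d * k) + d * (2 * N + (m - 1) * k : ℕ) := by
    obtain ⟨b, hb⟩ := tr
    refine ⟨2 * b + d * k, ?_⟩
    push_cast [Nat.cast_sub (show 1 ≤ m by omega)]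
    linear_combination 2 * hb
  have g1 := van_qPoch_div_qPoch (K := K) hζ hm0 hn hmn hd hdm tr k
  have g2 := van_qPoch_div_qPoch (K := K) hζ hm0 hn hmn hd hdm tdr k
  have main : Van ζ 0 (qPoch ((RatFunc.X : RatFunc K) ^ r) (RatFunc.X ^ d) k ^ 2 *
      (qPoch (RatFunc.X ^ ((d : ℤ) - r)) (RatFunc.X ^ d) k *
        qPoch (RatFunc.C c * RatFunc.X ^ r) (RatFunc.X ^ d) k) *
      qPoch (RatFunc.C c * RatFunc.X ^ (2 * r + d * k)) (RatFunc.X ^ d) (N - k) /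
      (qPoch (RatFunc.X ^ d) (RatFunc.X ^ d) k ^ 3 *
        qPoch (RatFunc.X ^ d / RatFunc.C c) (RatFunc.X ^ d) N)) := by
    by_cases h : c ^ n = 1
    · rw [hc_root h]
      simp only [map_one, one_mul, div_one]
      have hω := one_sub_X_pow_ne_zero (K := K) hn
      have hωv := (Van.one_sub_X_pow (K := K) hζn).mono zero_le_one
      have h1 := van_qPoch_div (K := K) hζ hm0 hn hmn hdm tr k
      have h4 := van_qPoch_div_pow (K := K) hζ hm0 hn hmn hdm t2r (N - k)
      have h5 := van_inv_qPoch_mul (K := K) hζ hm0 hn hmn hd hdm N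
      generalize he : (if N % m < k % m then 1 else 0) = e at h1
      -- The `N / m` zeros of `(q^d)_N` must be covered by one `(q^r)_k` and `(q^(2r+dk))_(N-k)`. If
      -- adding `k` and `N - k` modulo `m` produces a carry, then `N % m < k % m`, and `(q^r)_k` has
      -- exactly the extra zero `e = 1`.
      have hle : N / m ≤ e + k / m + (N - k) / m := by
        have hN : N = k + (N - k) := by omega
        have hd1 : N / m = k / m + (N - k) / m +
            if m ≤ k % m + (N - k) % m then 1 else 0 := by
          conv_lhs => rw [hN]
          exact Nat.add_div hm0
        by_cases hcmp : m ≤ k % m + (N - k) % m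
        · have hmod : N % m = k % m + (N - k) % m - m := by
            conv_lhs => rw [hN]
            rw [Nat.add_mod, Nat.mod_eq_sub_mod hcmp, Nat.mod_eq_of_lt]
            have := Nat.mod_lt k hm0
            have := Nat.mod_lt (N - k) hm0
            omega
          have := Nat.mod_lt (N - k) hm0
          rw [if_pos (by omega)] at he
          rw [hd1, if_pos hcmp]
          omega
        · rw [hd1, if_neg hcmp]
          omega
      obtain ⟨s, hs⟩ := Nat.exists_eq_add_of_le hle
      have h6 := ((((g1.pow 2).mul h1).mul g2).mul h4).mul (h5.mul (hωv.pow s))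
      simp only [zero_mul, add_zero] at h6
      convert h6 using 1
      have hs' : (1 - (RatFunc.X : RatFunc K) ^ n) ^ e * (1 - RatFunc.X ^ n) ^ (k / m) *
          (1 - RatFunc.X ^ n) ^ ((N - k) / m) =
          (1 - RatFunc.X ^ n) ^ (N / m) * (1 - RatFunc.X ^ n) ^ s := by
        rw [← pow_add, ← pow_add, ← pow_add, hs]
      rw [pow_add _ (k / m) e]
      have w1 : (1 - (RatFunc.X : RatFunc K) ^ n) ^ e ≠ 0 := pow_ne_zero _ hω
      have w2 : (1 - (RatFunc.X : RatFunc K) ^ n) ^ (k / m) ≠ 0 := pow_ne_zero _ hω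
      have w3 : (1 - (RatFunc.X : RatFunc K) ^ n) ^ ((N - k) / m) ≠ 0 := pow_ne_zero _ hω
      generalize (1 - (RatFunc.X : RatFunc K) ^ n) ^ e = W1 at *
      generalize (1 - (RatFunc.X : RatFunc K) ^ n) ^ (k / m) = W2 at *
      generalize (1 - (RatFunc.X : RatFunc K) ^ n) ^ ((N - k) / m) = W3 at *
      generalize (1 - (RatFunc.X : RatFunc K) ^ n) ^ (N / m) = W4 at *
      generalize (1 - (RatFunc.X : RatFunc K) ^ n) ^ s = W5 at *
      have e1 : W4 * W5 * (W1 * W2 * W3)⁻¹ = 1 := by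
        rw [← hs']; field_simp
      rw [← mul_one (_ / _), ← e1, mul_inv, mul_inv]
      ring
    · have h1 := (red_qPoch_div_C (ζ := ζ) (d := d) hc N).inv
        (qPoch_root_div_ne_zero_of_pow_ne_one hζn hc h N)
      have h2 := ((((g1.pow 2).mul g2).mul (van_qPoch_C (d := d) hζ0 c r k)).mul
        (van_qPoch_C (d := d) hζ0 c (2 * r + d * k) (N - k))).mul (Van.of_red h1)
      simp only [zero_mul, add_zero] at h2
      convert h2 using 1
      ring
  have hpre : Van ζ 0 ((RatFunc.C c * (RatFunc.X : RatFunc K) ^ r) ^ ((r - n) / (d : ℤ)) *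
      RatFunc.X ^ (d * k)) :=
    Van.of_red ((((Red.const c).mul (Red.var.zpow hζ0 r)).zpow
      (mul_ne_zero hC0 (zpow_ne_zero _ hζ0)) _).mul (Red.var.pow (d * k)))
  have h := (van_qInt (K := K) hζ0 hζ1 hζn).mul (hpre.mul main)
  simp only [add_zero] at h
  convert h using 1
  have e1 : qPoch (RatFunc.C c * RatFunc.X ^ (2 * r)) ((RatFunc.X : RatFunc K) ^ d) N =
      qPoch (RatFunc.C c * RatFunc.X ^ (2 * r)) (RatFunc.X ^ d) k *
        qPoch (RatFunc.C c * RatFunc.X ^ (2 * r + d * k)) (RatFunc.X ^ d) (N - k) := by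
    conv_lhs => rw [show N = k + (N - k) by omega]
    rw [qPoch_add, zpow_add₀ hX, zpow_mul _ (d : ℤ), zpow_natCast, zpow_natCast, mul_assoc]
  have e2 := qPoch_ne_zero_of_le hden hk
  rw [rhsCoeff, e1]
  field_simp

lemma van_one_sub_div [CharZero L] (hζ : IsPrimitiveRoot ζ m) (hm : 0 < m) (hn : 0 < n)
    (hmn : m ∣ n) {a : ℤ} (ha : a ≠ 0) :
    Van ζ 0 ((1 - (RatFunc.X : RatFunc K) ^ n) / (1 - RatFunc.X ^ a)) := by
  by_cases h : (m : ℤ) ∣ a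
  · have h1 := (Red.one_sub_zpow_div (K := K) hζ hm hn hmn h).inv
      (div_ne_zero (by exact_mod_cast ha) (by exact_mod_cast hn.ne'))
    rw [inv_div] at h1
    exact Van.of_red h1
  · exact Van.of_red ((Red.one.sub (Red.var.pow n)).div
      (Red.one.sub (Red.var.zpow (hζ.ne_zero hm.ne') a)) (hζ.one_sub_zpow_ne_zero h))

/-- A zero would give `d ∣ n`, hence `d = 1` and `N - j = n`, against `N < n`. -/
lemma add_mul_ne_zero (hgcd : Nat.gcd n d = 1) (hr : r + d * N = n) (hNn : N < n)
    (j : ℕ) : r + d * j ≠ 0 := by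
  intro h
  have h1 : (d : ℤ) * (N - j) = n := by linear_combination hr - h
  have h2 : (d : ℤ) ∣ n := ⟨_, h1.symm⟩
  have h3 : d ∣ n := by exact_mod_cast h2
  have h4 : d = 1 := by
    have := Nat.dvd_gcd h3 (dvd_refl d)
    rw [hgcd] at this
    exact Nat.dvd_one.1 this
  subst h4
  push_cast at h1
  omega

lemma van_qInt_sq_mul_harmSum [CharZero L] (hζ : IsPrimitiveRoot ζ m) (hm : 0 < m) (hn : 0 < n)
    (hmn : m ∣ n) (hd : 0 < d) (hr0 : ∀ j : ℕ, r + d * j ≠ 0) (k : ℕ) :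
    Van ζ 0 (qInt (RatFunc.X : RatFunc K) n ^ 2 * harmSum RatFunc.X d r k) := by
  have hX1 : 1 - (RatFunc.X : RatFunc K) ≠ 0 := by
    simpa using one_sub_X_pow_ne_zero (K := K) one_pos
  have key : ∀ a : ℤ, a ≠ 0 → Van ζ 0 (qInt (RatFunc.X : RatFunc K) n ^ 2 *
      (RatFunc.X ^ a / qInt RatFunc.X a ^ 2)) := by
    intro a ha
    have h1 := ((van_one_sub_div (K := K) hζ hm hn hmn ha).pow 2).mul
      (Van.of_red (Red.var.zpow (hζ.ne_zero hm.ne') a))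
    simp only [zero_mul, add_zero] at h1
    convert h1 using 1
    rw [qInt, qInt, zpow_natCast]
    have := one_sub_X_zpow_ne_zero (K := K) ha
    field_simp
  rw [harmSum, Finset.mul_sum]
  refine Van.sum _ fun j hj => ?_
  have hj1 : 1 ≤ j := (Finset.mem_Icc.1 hj).1
  rw [mul_add]
  refine Van.add ?_ (key _ ?_)
  · have := key (d * j : ℕ) (by positivity)
    rw [zpow_natCast] at this
    exact_mod_cast this
  · have := hr0 (j - 1)
    push_cast [Nat.cast_sub hj1] at this
    intro h
    apply this
    linear_combination h

lemma van_rhsSum [CharZero L] (hζ : IsPrimitiveRoot ζ m) (hm : 1 < m) (hn : 0 < n)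
    (hmn : m ∣ n) (hd : 0 < d) (hdm : Nat.Coprime d m) (hr : r + d * N = n)
    (hr0 : ∀ j : ℕ, r + d * j ≠ 0) (hc : c ≠ 0) (hc_root : c ^ n = 1 → c = 1)
    (hden : qPoch (RatFunc.C c * RatFunc.X ^ (2 * r)) ((RatFunc.X : RatFunc K) ^ d) N ≠ 0) :
    Van ζ 1 (rhsSum RatFunc.X (RatFunc.C c) n d r N) := by
  rw [rhsSum_eq]
  refine Van.sum _ fun k hk => ?_
  have hkN : k ≤ N := by have := Finset.mem_range.1 hk; omega
  refine (van_rhsCoeff hζ hm hn hmn hd hdm hr hc hc_root hden hkN).mul_right ?_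
  have h1 := van_qInt_sq_mul_harmSum (K := K) hζ (by omega : 0 < m) hn hmn hd hr0 k
  have h2 : Van ζ 0 (2 - (RatFunc.X : RatFunc K) ^ n) := by
    have := (Red.natCast (K := K) (ζ := ζ) 2).sub (Red.var.pow n)
    exact_mod_cast Van.of_red this
  have h3 := (Van.of_red (Red.one (K := K) (ζ := ζ))).sub (h2.mul_left h1)
  convert h3 using 1
  ring

end RightSide

/-! ### Exact transformations of the perturbed sums. -/

section Transformation

variable {F : Type*} [Field F]

/-- The factor by which `(q ^ a; q ^ d)_k ^ 2` changes when its two factors are replaced by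
`(q ^ (a + n); q ^ d)_k` and `(q ^ (a - n); q ^ d)_k`. -/
def pertFactor (q : F) (n d : ℕ) (a : ℤ) (k : ℕ) : F :=
  ∏ i ∈ Finset.range k,
    (1 + (2 - q ^ n - (q ^ n)⁻¹) * (q ^ (a + d * i) / (1 - q ^ (a + d * i)) ^ 2))

/-- Factor by factor, with `y = q^n`: `(1 - x y)(1 - x / y) = (1 - x)² + (2 - y - 1/y) x`. -/
lemma qPoch_mul_eq_pertFactor {q : F} (hq : q ≠ 0) (n d : ℕ) (a : ℤ) {k : ℕ}
    (h : qPoch (q ^ a) (q ^ d) k ≠ 0) :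
    qPoch (q ^ (a + n)) (q ^ d) k * qPoch (q ^ (a - n)) (q ^ d) k =
      qPoch (q ^ a) (q ^ d) k ^ 2 * pertFactor q n d a k := by
  rw [qPoch_ne_zero_iff] at h
  rw [qPoch, qPoch, qPoch, pertFactor, ← Finset.prod_mul_distrib, ← Finset.prod_pow,
    ← Finset.prod_mul_distrib]
  refine Finset.prod_congr rfl fun i hi => ?_
  have h1 := h i (by simpa using hi)
  have e : q ^ (a + d * i) = q ^ a * (q ^ d) ^ i := by
    rw [zpow_add₀ hq, zpow_mul, zpow_natCast, zpow_natCast]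
  rw [e, zpow_add₀ hq, zpow_sub₀ hq, zpow_natCast]
  have hn : q ^ n ≠ 0 := pow_ne_zero _ hq
  have e1 : q ^ a * q ^ n * (q ^ d) ^ i = q ^ a * (q ^ d) ^ i * q ^ n := by ring
  have e2 : q ^ a / q ^ n * (q ^ d) ^ i = q ^ a * (q ^ d) ^ i / q ^ n := by ring
  rw [e1, e2]
  generalize q ^ a * (q ^ d) ^ i = x at *
  generalize q ^ n = y at *
  field_simp
  ring

/-- Two instances of Watson's transformation for the perturbed left-hand side. -/
lemma sum_lhs_pert {q c : F} (hq : q ≠ 0) (hq1 : 1 - q ≠ 0) (hc : c ≠ 0) {n d N : ℕ} {r : ℤ}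
    (hd : 0 < d) (hr : r + d * N = n)
    (a1 : qPoch (q ^ d) (q ^ d) N ≠ 0) (a2 : qPoch (q ^ ((d : ℤ) - n)) (q ^ d) N ≠ 0)
    (a3 : qPoch (q ^ d / c) (q ^ d) N ≠ 0) (a4 : qPoch (q ^ ((d : ℤ) + n)) (q ^ d) N ≠ 0)
    (a5 : qPoch (q ^ (r + n)) (q ^ d) N ≠ 0) (a6 : qPoch (c * q ^ r) (q ^ d) N ≠ 0)
    (a7 : qPoch (c * q ^ (2 * r)) (q ^ d) N ≠ 0) (a8 : qPoch (q ^ r) (q ^ d) N ≠ 0) :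
    ∑ k ∈ Finset.range (N + 1), qInt q (2 * d * k + r) * lhsFactor q c d r k *
        (pertFactor q n d r k / pertFactor q n d d k) =
      ∑ k ∈ Finset.range (N + 1), rhsCoeff q c n d r N k * pertFactor q n d r k ∧
    ∑ k ∈ Finset.range (N + 1), qInt q (2 * d * k + r) * lhsFactor q c d r k *
        (pertFactor q n d r k / pertFactor q n d d k) ^ 2 =
      ∑ k ∈ Finset.range (N + 1), rhsCoeff q c n d r N k *
        (pertFactor q n d r k / pertFactor q n d d k) := by
  have hp : q ^ d ≠ 0 := pow_ne_zero _ hq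
  have hpN : (q ^ d) ^ N = q ^ ((n : ℤ) - r) := by
    rw [← hr, add_sub_cancel_left, zpow_mul, zpow_natCast, zpow_natCast]
  have z : ∀ a b : ℤ, q ^ a * q ^ b = q ^ (a + b) := fun a b => (zpow_add₀ hq a b).symm
  have z2 : ∀ a b : ℤ, q ^ a / q ^ b = q ^ (a - b) := fun a b => (zpow_sub₀ hq a b).symm
  have hqd : q ^ d = q ^ (d : ℤ) := (zpow_natCast q d).symm
  -- Dictionary for `watson`: `p = q^d`, `α = q^r`, `e = c q^r`, `l = q^(d-r)`. Then `α p^N = q^n`,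
  -- which yields the prefactor `[n]`, and `α² p^N = q^(r+n)`, `p^(-N) = q^(r-n)` are already a
  -- perturbed pair.
  have r1 : (q ^ r) ^ 2 * (q ^ d) ^ N = q ^ (r + n) := by
    rw [hpN, pow_two, z, z]; congr 1; ring
  have r2 : q ^ r * q ^ d / q ^ (r + n) = q ^ ((d : ℤ) - n) := by
    rw [hqd, z, z2]; congr 1; ring
  have r3 : q ^ r * q ^ d / (c * q ^ r) = q ^ d / c := by
    have := zpow_ne_zero r hq; field_simp
  have r4 : q ^ r * (q ^ d) ^ (N + 1) = q ^ ((d : ℤ) + n) := by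
    rw [pow_succ, hpN, hqd, z, z]; congr 1; ring
  have r5 : q ^ r * (c * q ^ r) = c * q ^ (2 * r) := by
    rw [two_mul, ← z]; ring
  have r6 : q ^ ((d : ℤ) - r) * q ^ r = q ^ d := by
    rw [z, hqd]; congr 1; ring
  have r7 : q ^ ((d : ℤ) - r) * q ^ (r + n) = q ^ ((d : ℤ) + n) := by
    rw [z]; congr 1; ring
  have r8 : q ^ ((d : ℤ) - r) * q ^ (r - n) = q ^ ((d : ℤ) - n) := by
    rw [z]; congr 1; ring
  have r9 : ((q ^ d) ^ N)⁻¹ = q ^ (r - n) := by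
    rw [hpN, ← zpow_neg]; congr 1; ring
  have r10 : q ^ ((d : ℤ) + n) / (q ^ (r + n) * (c * q ^ r)) * q ^ ((d : ℤ) - r) =
      q ^ (2 * (d : ℤ) - 3 * r) / c := by
    have : q ^ (2 * (d : ℤ) - 3 * r) = q ^ ((d : ℤ) + n) / (q ^ (r + n) * q ^ r) *
        q ^ ((d : ℤ) - r) := by
      rw [z, z2, z]; congr 1; ring
    rw [this, mul_left_comm]
    field_simp
  have r11 : q ^ r * (q ^ d) ^ N = q ^ (n : ℤ) := by
    rw [hpN, z]; congr 1; ring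
  have r12 : ∀ k : ℕ, q ^ r * ((q ^ d) ^ k) ^ 2 = q ^ (2 * (d : ℤ) * k + r) := by
    intro k
    rw [← pow_mul, ← pow_mul, ← zpow_natCast, z]; congr 1; push_cast; ring
  have r13 : (c * q ^ r) ^ ((r - n) / (d : ℤ)) = ((c * q ^ r) ^ N)⁻¹ := by
    have : (r - n) / (d : ℤ) = -N := by
      rw [← hr, show r - (r + d * N) = (d : ℤ) * (-N) by ring]
      exact Int.mul_ediv_cancel_left _ (by exact_mod_cast hd.ne')
    rw [this, zpow_neg, zpow_natCast]
  have hα : q ^ r ≠ 0 := zpow_ne_zero _ hq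
  have he : c * q ^ r ≠ 0 := mul_ne_zero hc hα
  have key : ∀ {β γ : F}, q ^ ((d : ℤ) - r) * β * γ = q ^ r * q ^ d →
      qPoch (q ^ ((d : ℤ) - r) * γ) (q ^ d) N ≠ 0 → qPoch (q ^ ((d : ℤ) - r) * β) (q ^ d) N ≠ 0 →
      _ := fun hl h7 h8 => watson hp hα he N hl a1 (by rwa [r1, r2]) (by rwa [r3]) (by rwa [r4])
        (by rwa [r1]) a6 h7 h8 (by rwa [r5])
  have ab : ∀ k ∈ Finset.range (N + 1), qPoch (q ^ (r + n)) (q ^ d) k *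
      qPoch (q ^ (r - n)) (q ^ d) k = qPoch (q ^ r) (q ^ d) k ^ 2 * pertFactor q n d r k :=
    fun k hk => qPoch_mul_eq_pertFactor hq n d r (qPoch_ne_zero_of_le a8 (by
      have := Finset.mem_range.1 hk; omega))
  have cd : ∀ k ∈ Finset.range (N + 1), qPoch (q ^ ((d : ℤ) - n)) (q ^ d) k *
      qPoch (q ^ ((d : ℤ) + n)) (q ^ d) k =
        qPoch (q ^ d) (q ^ d) k ^ 2 * pertFactor q n d d k := by
    intro k hk
    have := qPoch_mul_eq_pertFactor hq n d d (k := k) (by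
      rw [zpow_natCast]
      exact qPoch_ne_zero_of_le a1 (by have := Finset.mem_range.1 hk; omega))
    rw [zpow_natCast] at this
    rw [mul_comm, this]
  -- The part common to both cases, containing one factor `ρ / δ`; `Y / Z` holds the symbols
  -- depending on `β` and `γ`.
  have hwp : ∀ k ∈ Finset.range (N + 1), ∀ Y Z : F, (1 - q ^ (2 * (d : ℤ) * k + r)) *
      (wpTerm (q ^ d) (q ^ r) (q ^ (r + n)) (c * q ^ r) N 0 k *
        (Y * (q ^ ((d : ℤ) - r)) ^ k / Z)) =
      (1 - q) * (qInt q (2 * d * k + r) * (qPoch (q ^ r) (q ^ d) k ^ 3 *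
        qPoch (c * q ^ r) (q ^ d) k / (qPoch (q ^ d) (q ^ d) k ^ 3 * qPoch (q ^ d / c) (q ^ d) k) *
        (q ^ (2 * (d : ℤ) - 3 * r) / c) ^ k) *
        ((pertFactor q n d r k / pertFactor q n d d k)) * (Y / Z)) := by
    intro k hk Y Z
    have e0 : (1 - q) * qInt q (2 * d * k + r) = 1 - q ^ (2 * (d : ℤ) * k + r) := by
      rw [qInt, mul_div_cancel₀ _ hq1]
    have hQ := qPoch_ne_zero_of_le a1 (show k ≤ N by have := Finset.mem_range.1 hk; omega)
    have hR := qPoch_ne_zero_of_le a8 (show k ≤ N by have := Finset.mem_range.1 hk; omega)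
    simp only [wpTerm, qPoch_zero, r2, r3, r4, r9, mul_one]
    rw [← r10, ← mul_assoc (1 - q), ← mul_assoc (1 - q), ← mul_assoc (1 - q), e0, mul_pow]
    have e1 : pertFactor q n d r k / pertFactor q n d d k =
        (qPoch (q ^ (r + n)) (q ^ d) k * qPoch (q ^ (r - n)) (q ^ d) k /
          qPoch (q ^ r) (q ^ d) k ^ 2) /
        (qPoch (q ^ ((d : ℤ) - n)) (q ^ d) k * qPoch (q ^ ((d : ℤ) + n)) (q ^ d) k /
          qPoch (q ^ d) (q ^ d) k ^ 2) := by
      rw [ab k hk, cd k hk, mul_div_cancel_left₀ _ (pow_ne_zero 2 hR),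
        mul_div_cancel_left₀ _ (pow_ne_zero 2 hQ)]
    rw [e1]
    generalize qPoch (q ^ (r + n)) (q ^ d) k = A
    generalize qPoch (q ^ (r - n)) (q ^ d) k = B
    generalize qPoch (q ^ ((d : ℤ) - n)) (q ^ d) k = D
    generalize qPoch (q ^ ((d : ℤ) + n)) (q ^ d) k = E
    generalize qPoch (q ^ d / c) (q ^ d) k = G
    generalize qPoch (c * q ^ r) (q ^ d) k = H
    generalize qPoch (q ^ d) (q ^ d) k = Q at *
    generalize qPoch (q ^ r) (q ^ d) k = R at *
    generalize (q ^ ((d : ℤ) + n) / (q ^ (r + n) * (c * q ^ r))) ^ k = U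
    generalize (q ^ ((d : ℤ) - r)) ^ k = V
    generalize 1 - q ^ (2 * (d : ℤ) * k + r) = T
    have hR' : R ^ 3 * (R ^ 2)⁻¹ = R := by
      rw [pow_succ' R 2, mul_inv_cancel_right₀ (pow_ne_zero 2 hR)]
    have hQ' : (Q ^ 3)⁻¹ * Q ^ 2 = Q⁻¹ := by
      rw [pow_succ' Q 2, mul_inv, inv_mul_cancel_right₀ (pow_ne_zero 2 hQ)]
    calc _ = T * R * Q⁻¹ * (A * B * H * D⁻¹ * E⁻¹ * G⁻¹ * U * V * Y * Z⁻¹) := by ring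
      _ = T * (R ^ 3 * (R ^ 2)⁻¹) * ((Q ^ 3)⁻¹ * Q ^ 2) *
          (A * B * H * D⁻¹ * E⁻¹ * G⁻¹ * U * V * Y * Z⁻¹) := by rw [hR', hQ']
      _ = _ := by simp only [div_eq_mul_inv, mul_inv, inv_inv]; ring
  constructor
  -- Here `β, γ` stay unperturbed; in the second case they are the perturbed pair `q^(r+n),
  -- q^(r-n)`, contributing a second factor `ρ / δ`.
  · have W := key (β := q ^ r) (γ := q ^ r) (by rw [r6, mul_comm]) (by rwa [r6]) (by rwa [r6])
    rw [r1] at W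
    simp only [r3, r5, r6, r9, r11, r12] at W
    apply mul_left_cancel₀ hq1
    rw [Finset.mul_sum, Finset.mul_sum]
    rw [Finset.mul_sum] at W
    refine Eq.trans ?_ (W.trans ?_)
    · refine Finset.sum_congr rfl fun k hk => ?_
      rw [hwp k hk, lhsFactor]
      ring
    · refine Finset.sum_congr rfl fun k hk => ?_
      rw [rhsCoeff, r13, qInt, ← pow_mul]
      have e0 : (1 - q) * ((1 - q ^ (n : ℤ)) / (1 - q)) = 1 - q ^ (n : ℤ) :=
        mul_div_cancel₀ _ hq1
      rw [mul_right_comm (qPoch (q ^ (r + n)) (q ^ d) k), ab k hk]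
      simp only [← mul_assoc]
      rw [e0]
      ring
  · have W := key (β := q ^ (r + n)) (γ := q ^ (r - n)) (by rw [r7, hqd, z, z]; congr 1; ring)
      (by rwa [r8]) (by rwa [r7])
    rw [r1] at W
    simp only [r3, r5, r7, r8, r9, r11, r12] at W
    apply mul_left_cancel₀ hq1
    rw [Finset.mul_sum, Finset.mul_sum]
    rw [Finset.mul_sum] at W
    refine Eq.trans ?_ (W.trans ?_)
    · refine Finset.sum_congr rfl fun k hk => ?_
      rw [hwp k hk, ab k hk, cd k hk, lhsFactor]
      ring
    · refine Finset.sum_congr rfl fun k hk => ?_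
      rw [rhsCoeff, r13, qInt, ← pow_mul]
      have e0 : (1 - q) * ((1 - q ^ (n : ℤ)) / (1 - q)) = 1 - q ^ (n : ℤ) :=
        mul_div_cancel₀ _ hq1
      rw [mul_right_comm (qPoch (q ^ (r + n)) (q ^ d) k), ab k hk, mul_assoc (qPoch (q ^ d) (q ^ d) k), cd k hk]
      simp only [← mul_assoc]
      rw [e0]
      ring

end Transformation

/-! ### First-order expansions in a small parameter. -/

section Expansion

variable {K L : Type*} [Field K] [Field L] [Algebra K L] {ζ : L}

lemma Red.ne_zero {x : RatFunc K} {y : L} (h : Red ζ x y) (hy : y ≠ 0) : x ≠ 0 := by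
  obtain ⟨u, v, hv, rfl, rfl⟩ := h
  exact div_ne_zero (algebraMap_ne_zero_of_aeval (ζ := ζ) fun hu => hy (by simp [hu]))
    (algebraMap_ne_zero_of_aeval hv)

lemma Van.red_zero {x : RatFunc K} (h : Van ζ 1 x) : Red ζ x 0 := by
  obtain ⟨u, v, hv, hu, hx⟩ := h
  refine ⟨u, v, hv, ?_, hx⟩
  rw [pow_one, dvd_iff_isRoot, IsRoot, eval_map_algebraMap] at hu
  rw [hu, zero_div]

lemma Van.one : Van ζ 0 (1 : RatFunc K) := Van.of_red Red.one

/-- First-order expansion of a product of factors close to `1`. -/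
lemma van_prod_one_add {ε : RatFunc K} {e : ℕ} (hε : Van ζ e ε) {f : ℕ → RatFunc K} (k : ℕ)
    (hf : ∀ i < k, Van ζ 0 (f i)) :
    Van ζ (e + e) (∏ i ∈ Finset.range k, (1 + ε * f i) -
      (1 + ε * ∑ i ∈ Finset.range k, f i)) := by
  induction k with
  | zero => simpa using Van.zero _
  | succ k ih =>
    have ih := ih fun i hi => hf i (by omega)
    have hk := hf k (by omega)
    have hs : Van ζ 0 (∑ i ∈ Finset.range k, f i) :=
      Van.sum _ fun i hi => hf i (by have := Finset.mem_range.1 hi; omega)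
    have h1 : Van ζ 0 (1 + ε * f k) :=
      Van.one.add ((hε.mono (Nat.zero_le _)).mul_left hk)
    have h2 := (ih.mul_right h1).add ((hε.mul hε).mul_right (hs.mul_left hk))
    rw [Finset.prod_range_succ, Finset.sum_range_succ]
    convert h2 using 1
    ring

/-- First-order expansion of the inverse of an element close to `1`. -/
lemma van_inv_of_van_sub {ε x B : RatFunc K} {e : ℕ} (he : 0 < e) (hε : Van ζ e ε)
    (hB : Van ζ 0 B) (hx : Van ζ (e + e) (x - (1 + ε * B))) :
    x ≠ 0 ∧ Van ζ 0 x⁻¹ ∧ Van ζ (e + e) (x⁻¹ - (1 - ε * B)) := by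
  have h1 : Red ζ x 1 := by
    have h2 := ((hx.mono (show 1 ≤ e + e by omega)).add
      ((hε.mono (show 1 ≤ e by omega)).mul_right hB)).red_zero.add Red.one
    rw [zero_add] at h2
    convert h2 using 1
    ring
  have hx0 := h1.ne_zero one_ne_zero
  have hinv : Van ζ 0 x⁻¹ := Van.of_red (h1.inv one_ne_zero)
  refine ⟨hx0, hinv, ?_⟩
  have h3 : Van ζ 0 (1 - ε * B) := Van.one.sub ((hε.mono (Nat.zero_le _)).mul_left hB)
  have h4 := (((hε.mul hε).mul_right (hB.mul_left hB)).sub (hx.mul_right h3)).mul_right hinv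
  convert h4 using 1
  field_simp
  ring

lemma van_mul_two_sub_inv {ε x y A B : RatFunc K} {e : ℕ} (he : 0 < e) (hε : Van ζ e ε)
    (hA : Van ζ 0 A) (hB : Van ζ 0 B) (hx : Van ζ (e + e) (x - (1 + ε * A)))
    (hy : Van ζ (e + e) (y - (1 + ε * B))) :
    Van ζ (e + e) (x * (2 - y⁻¹) - (1 + ε * (A + B))) := by
  obtain ⟨-, h1, h2⟩ := van_inv_of_van_sub he hε hB hy
  have h3 : Van ζ 0 (2 - y⁻¹) := by
    have := (Van.one (ζ := ζ) (K := K)).add (Van.one.sub h1)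
    convert this using 1
    ring
  have h4 : Van ζ 0 (1 + ε * A) := Van.one.add ((hε.mono (Nat.zero_le _)).mul_left hA)
  have h5 := ((hx.mul_right h3).sub (h2.mul_right h4)).add ((hε.mul hε).mul_right (hA.mul_left hB))
  convert h5 using 1
  ring

/-- As a difference of squares, one factor has order `2e` and the other order `e`. -/
lemma van_div_sub_one_sq {ε x y A B : RatFunc K} {e : ℕ} (he : 0 < e) (hε : Van ζ e ε)
    (hA : Van ζ 0 A) (hB : Van ζ 0 B) (hx : Van ζ (e + e) (x - (1 + ε * A)))
    (hy : Van ζ (e + e) (y - (1 + ε * B))) :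
    Van ζ (e + e + e) ((x / y - 1) ^ 2 - ε ^ 2 * (A - B) ^ 2) := by
  obtain ⟨-, h1, h2⟩ := van_inv_of_van_sub he hε hB hy
  have h4 : Van ζ 0 (1 + ε * A) := Van.one.add ((hε.mono (Nat.zero_le _)).mul_left hA)
  have h5 : Van ζ (e + e) (x / y - 1 - ε * (A - B)) := by
    have := ((hx.mul_right h1).add (h2.mul_right h4)).sub
      ((hε.mul hε).mul_right (hA.mul_left hB))
    convert this using 1
    ring
  have h6 : Van ζ e (x / y - 1 + ε * (A - B)) := by
    have := (h5.mono (show e ≤ e + e by omega)).add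
      ((hε.mul_right (hA.sub hB)).add (hε.mul_right (hA.sub hB)))
    convert this using 1
    ring
  convert h5.mul h6 using 1
  ring

end Expansion

/-! ### Symmetry of the logarithmic derivatives. -/

section Main

lemma sum_reflect_symm {F : Type*} [Field F] (ψ : ℕ → F) (i j : ℕ) :
    ∑ l ∈ Finset.range j, ψ (i + j - l) - ∑ l ∈ Finset.range j, ψ (l + 1) =
      ∑ l ∈ Finset.range i, ψ (i + j - l) - ∑ l ∈ Finset.range i, ψ (l + 1) := by
  have h : ∀ i j : ℕ, ∑ l ∈ Finset.range j, ψ (i + j - l) =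
      ∑ l ∈ Finset.range (i + j), ψ (l + 1) - ∑ l ∈ Finset.range i, ψ (l + 1) := by
    intro i j
    rw [Finset.sum_range_add, add_sub_cancel_left,
      ← Finset.sum_range_reflect (fun l => ψ (i + l + 1))]
    refine Finset.sum_congr rfl fun l hl => congrArg ψ ?_
    have := Finset.mem_range.1 hl
    omega
  have h' := h j i
  rw [add_comm j i] at h'
  rw [h, h']
  ring

variable {K L : Type*} [Field K] [Field L] [Algebra K L] {ζ : L} {n d N : ℕ} {r : ℤ} {c : K}

/-- The logarithmic derivative of `pertFactor`. -/
def pertSum {F : Type*} [Field F] (q : F) (d : ℕ) (a : ℤ) (k : ℕ) : F :=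
  ∑ i ∈ Finset.range k, q ^ (a + d * i) / (1 - q ^ (a + d * i)) ^ 2

lemma red_pertSum (hζ0 : ζ ≠ 0) {a : ℤ} {k : ℕ} (h : ∀ i < k, 1 - ζ ^ (a + d * i) ≠ 0) :
    Red ζ (pertSum (RatFunc.X : RatFunc K) d a k) (pertSum ζ d a k) :=
  Red.sum _ fun i hi => (Red.var.zpow hζ0 _).div ((Red.one.sub (Red.var.zpow hζ0 _)).pow 2)
    (pow_ne_zero _ (h i (Finset.mem_range.1 hi)))

/-- The function `x / (1 - x)²` is invariant under `x ↦ 1/x` and `ζ^(r + d l) = ζ^(-d (N - l))`, so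
both sums run over the same function `ψ`, from opposite ends; `sum_reflect_symm` compares them. -/
lemma pertSum_root_symm (hζ : IsPrimitiveRoot ζ n) (hn : 0 < n) (hr : r + d * N = n)
    {i j : ℕ} (hij : i + j = N) :
    pertSum ζ d r i - pertSum ζ d d i = pertSum ζ d r j - pertSum ζ d d j := by
  have hζ0 : ζ ≠ 0 := hζ.ne_zero hn.ne'
  set ψ : ℕ → L := fun l => ζ ^ (d * l) / (1 - ζ ^ (d * l)) ^ 2 with hψ
  have h1 : ∀ k, pertSum ζ d d k = ∑ l ∈ Finset.range k, ψ (l + 1) := by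
    intro k
    refine Finset.sum_congr rfl fun l _ => ?_
    have : ζ ^ ((d : ℤ) + d * l) = ζ ^ (d * (l + 1)) := by
      rw [← zpow_natCast]; congr 1; push_cast; ring
    rw [this]
  have h2 : ∀ k ≤ N, pertSum ζ d r k = ∑ l ∈ Finset.range k, ψ (i + j - l) := by
    intro k hk
    refine Finset.sum_congr rfl fun l hl => ?_
    have hl' : l ≤ N := by have := Finset.mem_range.1 hl; omega
    have : ζ ^ (r + d * l) = (ζ ^ (d * (i + j - l)))⁻¹ := by
      apply eq_inv_of_mul_eq_one_left
      rw [← zpow_natCast, ← zpow_add₀ hζ0, hij]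
      push_cast [Nat.cast_sub hl']
      rw [show r + d * l + d * ((N : ℤ) - l) = n by rw [← hr]; ring, zpow_natCast,
        hζ.pow_eq_one]
    rw [this, hψ]
    have hx : ζ ^ (d * (i + j - l)) ≠ 0 := pow_ne_zero _ hζ0
    simp only
    generalize ζ ^ (d * (i + j - l)) = x at *
    -- At `x = 1` both sides are divisions by zero and agree by convention.
    by_cases hx1 : 1 - x = 0
    · have : x = 1 := (sub_eq_zero.1 hx1).symm
      simp [this]
    · have h3 : 1 - x⁻¹ = -((1 - x) / x) := by rw [sub_div, div_self hx, one_div]; ring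
      rw [h3]
      field_simp
  rw [h1, h1, h2 i (by omega), h2 j (by omega)]
  exact (sum_reflect_symm ψ i j).symm

lemma harmSum_eq {F : Type*} [Field F] (q : F) (d : ℕ) (r : ℤ) (k : ℕ) :
    harmSum q d r k = (1 - q) ^ 2 * (pertSum q d r k + pertSum q d d k) := by
  have h : Finset.Icc 1 k = (Finset.range k).image (· + 1) := by
    ext j
    simp only [Finset.mem_Icc, Finset.mem_image, Finset.mem_range]
    exact ⟨fun h => ⟨j - 1, by omega, by omega⟩, by rintro ⟨i, hi, rfl⟩; omega⟩
  rw [harmSum, h, Finset.sum_image (fun a _ b _ hab => by simpa using hab), pertSum, pertSum,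
    ← Finset.sum_add_distrib, Finset.mul_sum]
  refine Finset.sum_congr rfl fun i _ => ?_
  have e1 : (d : ℤ) * (i + 1 : ℕ) = d + d * i := by push_cast; ring
  have e2 : (d : ℤ) + d * i - d + r = r + d * i := by ring
  have e3 : q ^ (d * (i + 1)) = q ^ ((d : ℤ) + d * i) := by
    rw [← zpow_natCast, ← e1, Nat.cast_mul]
  rw [e3, qInt, qInt, e1, e2, div_pow, div_pow]
  simp only [div_eq_mul_inv, mul_inv, inv_inv]
  ring

end Main

/-! ### The congruence to order five at primitive roots of unity. -/

section Supercongruence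

variable {K L : Type*} [Field K] [Field L] [Algebra K L] {ζ : L} {n d N : ℕ} {r : ℤ} {c : K}

lemma qPoch_C_mul_X_zpow_ne_zero {a : ℤ} {k : ℕ} (h : ∀ j < k, a + d * j ≠ 0) :
    qPoch (RatFunc.C c * RatFunc.X ^ a) ((RatFunc.X : RatFunc K) ^ d) k ≠ 0 := by
  rw [qPoch_ne_zero_iff]
  intro j hj
  have e : RatFunc.C c * RatFunc.X ^ a * ((RatFunc.X : RatFunc K) ^ d) ^ j =
      RatFunc.C c * RatFunc.X ^ (a + d * j) := by
    rw [zpow_add₀ RatFunc.X_ne_zero, zpow_mul, zpow_natCast, zpow_natCast, mul_assoc]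
  rw [e]
  exact one_sub_C_mul_X_zpow_ne_zero (h j hj)

lemma qPoch_X_zpow_ne_zero {a : ℤ} {k : ℕ} (h : ∀ j < k, a + d * j ≠ 0) :
    qPoch (RatFunc.X ^ a) ((RatFunc.X : RatFunc K) ^ d) k ≠ 0 := by
  simpa using qPoch_C_mul_X_zpow_ne_zero (c := (1 : K)) h

lemma sub_add_mul_ne_zero (hgcd : Nat.gcd n d = 1) (hNn : N < n) {j : ℕ} (hj : j < N) :
    (d : ℤ) - n + d * j ≠ 0 := by
  intro h
  have h1 : d * (1 + j) = n := by zify; linear_combination h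
  have h2 := Nat.dvd_gcd ⟨_, h1.symm⟩ (dvd_refl d)
  rw [hgcd, Nat.dvd_one] at h2
  subst h2
  omega

/-- A zero would give `d (N - j) = 2 n`, so `d ∣ 2` by coprimality, and then `N - j ≥ n`, against `N
< n`. -/
lemma add_add_mul_ne_zero (hgcd : Nat.gcd n d = 1) (hr : r + d * N = n) (hNn : N < n) (j : ℕ) :
    r + n + d * j ≠ 0 := by
  intro h
  have h1 : (d : ℤ) * (N - j) = 2 * n := by linear_combination hr - h
  have h2 : d ∣ n * 2 := by
    have : (d : ℤ) ∣ n * 2 := ⟨_, by rw [h1, mul_comm]⟩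
    exact_mod_cast this
  have h3 : d ∣ 2 := Nat.Coprime.dvd_of_dvd_mul_left (Nat.Coprime.symm hgcd) h2
  have h4 := Nat.le_of_dvd two_pos h3
  interval_cases d <;> push_cast at h1 <;> omega

/-- The terms of the left-hand side beyond the index `N` vanish to order five. -/
lemma van_lhsTerm_of_lt (hζ : IsPrimitiveRoot ζ n) (hn : 1 < n) (hdn : Nat.Coprime d n)
    (hr : r + d * N = n) (hNn : N < n) (hc : c ≠ 0) (hc_root : c ^ n = 1 → c = 1) {k : ℕ}
    (hNk : N < k) (hk : k < n) :
    Van ζ 5 (qInt (RatFunc.X : RatFunc K) (2 * d * k + r) *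
      lhsFactor RatFunc.X (RatFunc.C c) d r k) := by
  have hn0 : 0 < n := by omega
  have hζ0 : ζ ≠ 0 := hζ.ne_zero hn0.ne'
  have hC0 : algebraMap K L c ≠ 0 := by simpa using hc
  have hq : Red ζ ((RatFunc.X : RatFunc K) ^ d) (ζ ^ d) := Red.var.pow d
  have h1 : Van ζ 1 (qPoch ((RatFunc.X : RatFunc K) ^ r) (RatFunc.X ^ d) k) := by
    have := (Red.var.zpow (K := K) hζ0 r).qPoch hq k
    rw [zpow_root_eq hζ hn0 (dvd_refl n) hr, Nat.mod_eq_of_lt hNn,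
      qPoch_inv_pow_eq_zero (pow_ne_zero _ hζ0) hNk] at this
    exact Van.of_red_zero this
  have h2 := Van.of_red ((hq.qPoch hq k).inv (qPoch_root_ne_zero hζ hdn hk))
  have h3 := Van.of_red ((red_qPoch_div_C (d := d) hc k).inv
    (qPoch_root_div_ne_zero hζ (dvd_refl n) hdn hc hc_root hk))
  have h4 := Van.of_red (((Red.var.zpow (K := K) hζ0 (2 * (d : ℤ) - 3 * r)).div
    (Red.const c) hC0).pow k)
  have h5 := Van.of_red (Red.qInt (K := K) hζ0 (hζ.ne_one hn) (2 * d * k + r))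
  have h6 := ((((h1.mul_right h2).pow 5).mul_right ((van_qPoch_C (d := d) hζ0 c r k).mul_left h3)).mul_right
    h4).mul_right h5
  convert h6 using 1
  rw [lhsFactor]
  ring

lemma red_lhsTerm (hζ : IsPrimitiveRoot ζ n) (hn : 1 < n) (hdn : Nat.Coprime d n)
    (hc : c ≠ 0) (hc_root : c ^ n = 1 → c = 1) (r : ℤ) {k : ℕ} (hk : k < n) :
    Red ζ (qInt (RatFunc.X : RatFunc K) (2 * d * k + r) * lhsFactor RatFunc.X (RatFunc.C c) d r k)
      (qInt ζ (2 * d * k + r) * lhsFactor ζ (algebraMap K L c) d r k) := by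
  have hζ0 : ζ ≠ 0 := hζ.ne_zero (by omega)
  have hqd : Red ζ ((RatFunc.X : RatFunc K) ^ d) (ζ ^ d) := Red.var.pow d
  have hqr : Red ζ ((RatFunc.X : RatFunc K) ^ r) (ζ ^ r) := Red.var.zpow hζ0 r
  have hCc : algebraMap K L c ≠ 0 := by simpa using hc
  refine (Red.qInt hζ0 (hζ.ne_one hn) _).mul (((((hqr.qPoch hqd k).pow 5).mul
    (((Red.const c).mul hqr).qPoch hqd k)).div (((hqd.qPoch hqd k).pow 5).mul
      (red_qPoch_div_C hc k)) ?_).mul (((Red.var.zpow hζ0 _).div (Red.const c) hCc).pow k))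
  exact mul_ne_zero (pow_ne_zero _ (qPoch_root_ne_zero hζ hdn hk))
    (qPoch_root_div_ne_zero hζ (dvd_refl n) hdn hc hc_root hk)

/-- Termwise this is `T = 2 T x - T x² + T (x - 1)²` with `x = ρ / δ`, where `W1` and `W2` evaluate
the sums of the first two terms. -/
lemma sum_perturbation_identity {F : Type*} [Field F] {T E ρ δ A B : ℕ → F} {ε κ : F}
    (s : Finset ℕ) (W1 : ∑ k ∈ s, T k * (ρ k / δ k) = ∑ k ∈ s, E k * ρ k)
    (W2 : ∑ k ∈ s, T k * (ρ k / δ k) ^ 2 = ∑ k ∈ s, E k * (ρ k / δ k)) :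
    ∑ k ∈ s, E k * (ρ k * (2 - (δ k)⁻¹) - (1 + ε * (A k + B k))) +
        ∑ k ∈ s, E k * ((ε + κ) * (A k + B k)) +
        ∑ k ∈ s, T k * ((ρ k / δ k - 1) ^ 2 - ε ^ 2 * (A k - B k) ^ 2) +
        ε ^ 2 * ∑ k ∈ s, T k * (A k - B k) ^ 2 =
      ∑ k ∈ s, T k - ∑ k ∈ s, E k * (1 - κ * (A k + B k)) := by
  have e1 : ∀ k ∈ s,
      E k * (ρ k * (2 - (δ k)⁻¹) - (1 + ε * (A k + B k))) + E k * ((ε + κ) * (A k + B k)) +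
        T k * ((ρ k / δ k - 1) ^ 2 - ε ^ 2 * (A k - B k) ^ 2) +
        ε ^ 2 * (T k * (A k - B k) ^ 2) =
      T k - E k * (1 - κ * (A k + B k)) +
        2 * (E k * ρ k - T k * (ρ k / δ k)) -
        (E k * (ρ k / δ k) - T k * (ρ k / δ k) ^ 2) := by
    intro k _
    ring
  rw [Finset.mul_sum, ← Finset.sum_add_distrib, ← Finset.sum_add_distrib,
    ← Finset.sum_add_distrib, Finset.sum_congr rfl e1, Finset.sum_sub_distrib,
    Finset.sum_add_distrib, Finset.sum_sub_distrib, ← Finset.mul_sum, Finset.sum_sub_distrib,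
    Finset.sum_sub_distrib, W1, W2]
  ring

/-- If two transformation formulas hold for first-order perturbations `T ρ / δ` and `T (ρ / δ) ^ 2`
of `T`, then the sum of `T` is determined to order five. -/
lemma van_sum_sub_sum {T E ρ δ A B : ℕ → RatFunc K} {ε κ : RatFunc K} (N : ℕ)
    (hε : Van ζ 2 ε) (hκ : Van ζ 4 (ε + κ))
    (hT : ∀ k ∈ Finset.range (N + 1), Van ζ 0 (T k))
    (hE : ∀ k ∈ Finset.range (N + 1), Van ζ 1 (E k))
    (hA : ∀ k ∈ Finset.range (N + 1), Van ζ 0 (A k))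
    (hB : ∀ k ∈ Finset.range (N + 1), Van ζ 0 (B k))
    (hρ : ∀ k ∈ Finset.range (N + 1), Van ζ (2 + 2) (ρ k - (1 + ε * A k)))
    (hδ : ∀ k ∈ Finset.range (N + 1), Van ζ (2 + 2) (δ k - (1 + ε * B k)))
    (hsymm : Van ζ 1 (∑ k ∈ Finset.range (N + 1), T k * (A k - B k) ^ 2))
    (W1 : ∑ k ∈ Finset.range (N + 1), T k * (ρ k / δ k) = ∑ k ∈ Finset.range (N + 1), E k * ρ k)
    (W2 : ∑ k ∈ Finset.range (N + 1), T k * (ρ k / δ k) ^ 2 =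
      ∑ k ∈ Finset.range (N + 1), E k * (ρ k / δ k)) :
    Van ζ 5 (∑ k ∈ Finset.range (N + 1), T k -
      ∑ k ∈ Finset.range (N + 1), E k * (1 - κ * (A k + B k))) := by
  have p1 : Van ζ 5 (∑ k ∈ Finset.range (N + 1),
      E k * (ρ k * (2 - (δ k)⁻¹) - (1 + ε * (A k + B k)))) :=
    Van.sum _ fun k hk => by
      have h := van_mul_two_sub_inv two_pos hε (hA k hk) (hB k hk) (hρ k hk) (hδ k hk)
      exact Van.mul (e := 1) (e' := 4) (hE k hk) h
  have p2 : Van ζ 5 (∑ k ∈ Finset.range (N + 1), E k * ((ε + κ) * (A k + B k))) :=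
    Van.sum _ fun k hk => by
      have h := hκ.mul_right ((hA k hk).add (hB k hk))
      exact Van.mul (e := 1) (e' := 4) (hE k hk) h
  have p3 : Van ζ 5 (∑ k ∈ Finset.range (N + 1),
      T k * ((ρ k / δ k - 1) ^ 2 - ε ^ 2 * (A k - B k) ^ 2)) :=
    Van.sum _ fun k hk => by
      have h := van_div_sub_one_sq two_pos hε (hA k hk) (hB k hk) (hρ k hk) (hδ k hk)
      exact (hT k hk).mul_left (h.mono (by omega))
  -- Order `2 * 2 + 1`: this is where the antisymmetry gains the fifth zero.
  have p4 := (hε.pow 2).mul hsymm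
  have h := ((p1.add p2).add p3).add p4
  rwa [sum_perturbation_identity _ W1 W2] at h

/-- The congruence to order five at a primitive `n`-th root of unity, for the sum up to `N`. -/
lemma van_lhsSum_sub_rhsSum [CharZero L] (hζ : IsPrimitiveRoot ζ n) (hn : 1 < n) (hd : 0 < d)
    (hgcd : Nat.gcd n d = 1) (hr : r + d * N = n) (hNn : N < n)
    (hc : c ≠ 0) (hc_root : c ^ n = 1 → c = 1)
    (hden : qPoch (RatFunc.C c * RatFunc.X ^ (2 * r)) ((RatFunc.X : RatFunc K) ^ d) N ≠ 0) :
    Van ζ 5 (lhsSum RatFunc.X (RatFunc.C c) d r N - rhsSum RatFunc.X (RatFunc.C c) n d r N) := by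
  have hn0 : 0 < n := by omega
  have hdn : Nat.Coprime d n := Nat.Coprime.symm hgcd
  have hζ0 : ζ ≠ 0 := hζ.ne_zero hn0.ne'
  have hζ1 : ζ ≠ 1 := hζ.ne_one hn
  have hX0 : (RatFunc.X : RatFunc K) ≠ 0 := RatFunc.X_ne_zero
  have hX1 : 1 - (RatFunc.X : RatFunc K) ≠ 0 := by
    simpa using one_sub_X_pow_ne_zero (K := K) one_pos
  have hr0 := add_mul_ne_zero hgcd hr hNn
  have hC0 : RatFunc.C c ≠ 0 := by simpa using hc
  obtain ⟨W1, W2⟩ := sum_lhs_pert hX0 hX1 hC0 (r := r) hd hr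
    (by rw [← zpow_natCast]; exact qPoch_X_zpow_ne_zero fun j _ => by positivity)
    (qPoch_X_zpow_ne_zero fun j hj => sub_add_mul_ne_zero hgcd hNn hj)
    (by
      have := qPoch_C_mul_X_zpow_ne_zero (K := K) (c := c⁻¹) (d := d) (a := d) (k := N)
        fun j _ => by positivity
      rwa [map_inv₀, inv_mul_eq_div, zpow_natCast] at this)
    (qPoch_X_zpow_ne_zero fun j _ => by positivity)
    (qPoch_X_zpow_ne_zero fun j _ => add_add_mul_ne_zero hgcd hr hNn j)
    (qPoch_C_mul_X_zpow_ne_zero fun j _ => hr0 j) hden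
    (qPoch_X_zpow_ne_zero fun j _ => hr0 j)
  have hqn : (RatFunc.X : RatFunc K) ^ n ≠ 0 := pow_ne_zero _ hX0
  have hω : Van ζ 1 (1 - (RatFunc.X : RatFunc K) ^ n) := Van.one_sub_X_pow hζ.pow_eq_one
  have hqninv : Van ζ 0 ((RatFunc.X : RatFunc K) ^ n)⁻¹ :=
    Van.of_red ((Red.var.pow n).inv (pow_ne_zero _ hζ0))
  have hε : Van ζ 2 (2 - (RatFunc.X : RatFunc K) ^ n - (RatFunc.X ^ n)⁻¹) := by
    have := ((hω.mul hω).mul_right hqninv).neg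
    convert this using 1
    field_simp; ring
  -- The sum equals `-(1 - q^n)^4 / q^n`, which explains the factor `2 - q^n` of the theorem.
  have hκ : Van ζ 4 (2 - (RatFunc.X : RatFunc K) ^ n - (RatFunc.X ^ n)⁻¹ +
      (1 - RatFunc.X ^ n) ^ 2 * (2 - RatFunc.X ^ n)) := by
    have := ((hω.pow 4).mul_right hqninv).neg
    convert this using 1
    field_simp; ring
  have hle : ∀ k ∈ Finset.range (N + 1), k ≤ N := fun k hk => by
    have := Finset.mem_range.1 hk; omega
  have rootr : ∀ i < N, 1 - ζ ^ (r + d * (i : ℤ)) ≠ 0 := fun i hi => by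
    refine hζ.one_sub_zpow_ne_zero fun h => ?_
    have := (modEq_of_dvd_add_mul hdn (dvd_add_mul_self (dvd_refl n) hr) i).1 h
    rw [Nat.ModEq, Nat.mod_eq_of_lt hNn, Nat.mod_eq_of_lt (by omega)] at this
    omega
  have rootd : ∀ i < N, 1 - ζ ^ ((d : ℤ) + d * (i : ℤ)) ≠ 0 := fun i hi => by
    have := (qPoch_ne_zero_iff _ _ _).1 (qPoch_root_ne_zero hζ hdn hNn) i hi
    rw [zpow_add₀ hζ0, zpow_mul, zpow_natCast, zpow_natCast]
    exact this
  have redA : ∀ k ∈ Finset.range (N + 1), Red ζ (pertSum (RatFunc.X : RatFunc K) d r k)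
      (pertSum ζ d r k) := fun k hk =>
    red_pertSum hζ0 fun i hi => rootr i (hi.trans_le (hle k hk))
  have redB : ∀ k ∈ Finset.range (N + 1), Red ζ (pertSum (RatFunc.X : RatFunc K) d d k)
      (pertSum ζ d d k) := fun k hk =>
    red_pertSum hζ0 fun i hi => rootd i (hi.trans_le (hle k hk))
  have hpert : ∀ a : ℤ, (∀ i < N, 1 - ζ ^ (a + d * (i : ℤ)) ≠ 0) → ∀ k ∈ Finset.range (N + 1),
      Van ζ (2 + 2) (pertFactor (RatFunc.X : RatFunc K) n d a k -
        (1 + (2 - RatFunc.X ^ n - (RatFunc.X ^ n)⁻¹) * pertSum RatFunc.X d a k)) :=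
    fun a ha k hk => van_prod_one_add hε k fun i hi => Van.of_red ((Red.var.zpow hζ0 _).div
      ((Red.one.sub (Red.var.zpow hζ0 _)).pow 2)
      (pow_ne_zero _ (ha i (hi.trans_le (hle k hk)))))
  have redT : ∀ k ∈ Finset.range (N + 1), Red ζ
      (qInt (RatFunc.X : RatFunc K) (2 * d * k + r) * lhsFactor RatFunc.X (RatFunc.C c) d r k)
      (qInt ζ (2 * d * k + r) * lhsFactor ζ (algebraMap K L c) d r k) := fun k hk =>
    red_lhsTerm hζ hn hdn hc hc_root r ((hle k hk).trans_lt hNn)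
  have hsymm : Van ζ 1 (∑ k ∈ Finset.range (N + 1),
      qInt (RatFunc.X : RatFunc K) (2 * d * k + r) * lhsFactor RatFunc.X (RatFunc.C c) d r k *
        (pertSum RatFunc.X d r k - pertSum RatFunc.X d d k) ^ 2) := by
    have h1 := Red.sum _ fun k hk => (redT k hk).mul (((redA k hk).sub (redB k hk)).pow 2)
    rw [sum_eq_zero_of_antisymm (F := L) (t := N)] at h1
    · exact Van.of_red_zero h1
    · intro i j hij
      rw [lhsTerm_root_antisymm hζ hn0 (dvd_refl n) hdn hr hc hc_root
        (by rw [Nat.mod_eq_of_lt hNn]; exact hij), pertSum_root_symm hζ hn0 hr hij, neg_mul]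
  have key := van_sum_sub_sum N hε hκ (fun k hk => Van.of_red (redT k hk))
    (fun k hk => van_rhsCoeff hζ hn hn0 (dvd_refl n) hd hdn hr hc hc_root hden (hle k hk))
    (fun k hk => Van.of_red (redA k hk)) (fun k hk => Van.of_red (redB k hk))
    (hpert r rootr) (hpert d rootd) hsymm W1 W2
  rw [lhsSum_eq, rhsSum_eq]
  convert key using 5 with k _
  rw [harmSum_eq, qInt, zpow_natCast]
  field_simp

end Supercongruence

/-! ### Roots of the modulus. -/

section Divisors

variable {K : Type*} [Field K] {n : ℕ}

lemma qIntPoly_mul (n : ℕ) : qIntPoly K n * (X - 1) = X ^ n - 1 := geom_sum_mul _ _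

lemma separable_X_pow_sub_one [CharZero K] (hn : 0 < n) : (X ^ n - 1 : K[X]).Separable := by
  simpa using separable_X_pow_sub_C (1 : K) (by exact_mod_cast hn.ne') one_ne_zero

lemma qIntPoly_ne_zero (hn : 0 < n) : qIntPoly K n ≠ 0 := by
  intro h
  have h1 := qIntPoly_mul (K := K) n
  rw [h, zero_mul] at h1
  exact X_pow_sub_C_ne_zero hn (1 : K) (by simpa using h1.symm)

lemma rootMultiplicity_map_le_one {L : Type*} [Field L] [Algebra K L] [CharZero K] (hn : 0 < n)
    {Q : K[X]} (hQ : Q ∣ X ^ n - 1) (ζ : L) :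
    (Q.map (algebraMap K L)).rootMultiplicity ζ ≤ 1 :=
  rootMultiplicity_le_one_of_separable (((separable_X_pow_sub_one hn).of_dvd hQ).map) ζ

lemma pow_eq_one_and_ne_one_of_aeval_qIntPoly {L : Type*} [Field L] [CharZero L] [Algebra K L] (hn : 0 < n) {ζ : L}
    (h : aeval ζ (qIntPoly K n) = 0) : ζ ^ n = 1 ∧ ζ ≠ 1 := by
  constructor
  · have h1 := congrArg (aeval ζ) (qIntPoly_mul (K := K) n)
    rw [map_mul, h, zero_mul] at h1
    exact sub_eq_zero.1 (by simpa using h1.symm)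
  · rintro rfl
    simp [qIntPoly, hn.ne'] at h

end Divisors

/-! ### Assembly over all roots of the modulus. -/

theorem theorem5p1 {K : Type*} [Field K] [CharZero K] (c : K) (n d : ℕ) (r : ℤ) (M N : ℕ)
    (hn : 0 < n) (hd : 0 < d) (hgcd : Nat.gcd n d = 1)
    (hr_lower : (d : ℤ) + n - d * n ≤ r) (hr_upper : r ≤ n) (hmod : (n : ℤ) ≡ r [ZMOD d])
    (hN : (N : ℤ) = (n - r) / d) (hM : M = N ∨ M = n - 1)
    (hc : c ≠ 0) (hc_root : c ^ n = 1 → c = 1)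
    (hden : qPoch (RatFunc.C c * RatFunc.X ^ (2 * r)) ((RatFunc.X : RatFunc K) ^ d) N ≠ 0) :
    RatCongr (qIntPoly K n * Polynomial.cyclotomic n K ^ 4)
      (lhsSum RatFunc.X (RatFunc.C c) d r M)
      (rhsSum RatFunc.X (RatFunc.C c) n d r N) := by
  have hr : r + d * N = n := by
    have h1 : (d : ℤ) ∣ n - r := by
      rw [← dvd_neg, neg_sub]; exact hmod.dvd
    rw [hN, Int.mul_ediv_cancel' h1]; ring
  -- The lower bound on `r` says exactly that `N ≤ n - 1`.
  have hNn : N < n := by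
    have h1 : (d : ℤ) * (N + 1) ≤ d * n := by linear_combination hr_lower + hr
    have h2 := le_of_mul_le_mul_left h1 (by exact_mod_cast hd)
    exact_mod_cast h2
  rcases (show n = 1 ∨ 1 < n by omega) with rfl | hn1
  -- For `n = 1` the modulus has the root `1`, outside the reach of the local argument, but both
  -- sides are equal.
  · obtain rfl : N = 0 := by omega
    obtain rfl : r = 1 := by simpa using hr
    obtain rfl : M = 0 := by omega
    have hX1 : 1 - (RatFunc.X : RatFunc K) ≠ 0 := by
      simpa using one_sub_X_pow_ne_zero (K := K) one_pos
    refine ⟨0, 1, isCoprime_one_left, ?_⟩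
    simp [lhsSum, rhsSum, harmSum, qInt, hX1]
  have hdvd : cyclotomic n K ∣ qIntPoly K n :=
    cyclotomic_dvd_geom_sum_of_dvd K (dvd_refl n) hn1.ne'
  have hq0 : qIntPoly K n ≠ 0 := qIntPoly_ne_zero hn
  have hq1 : qIntPoly K n ∣ X ^ n - 1 := ⟨_, (qIntPoly_mul n).symm⟩
  have hP : qIntPoly K n * cyclotomic n K ^ 4 ≠ 0 :=
    mul_ne_zero hq0 (pow_ne_zero _ (cyclotomic_ne_zero n K))
  have hr0 := add_mul_ne_zero hgcd hr hNn
  refine ratCongr_of_van (L := AlgebraicClosure K) hP fun ζ hζ => ?_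
  have hroot : aeval ζ (qIntPoly K n) = 0 := by
    rw [map_mul, mul_eq_zero, map_pow] at hζ
    rcases hζ with h | h
    · exact h
    · obtain ⟨Q, hQ⟩ := hdvd
      rw [hQ, map_mul, pow_eq_zero_iff (by norm_num) |>.1 h, zero_mul]
  obtain ⟨hζn, hζ1⟩ := pow_eq_one_and_ne_one_of_aeval_qIntPoly hn hroot
  have hmult : ((qIntPoly K n * cyclotomic n K ^ 4).map
      (algebraMap K (AlgebraicClosure K))).rootMultiplicity ζ =
      ((qIntPoly K n).map (algebraMap K (AlgebraicClosure K))).rootMultiplicity ζ +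
        4 * ((cyclotomic n K).map (algebraMap K (AlgebraicClosure K))).rootMultiplicity ζ := by
    classical
    rw [Polynomial.map_mul, Polynomial.map_pow, rootMultiplicity_mul, ← count_roots (_ ^ 4),
      roots_pow, Multiset.count_nsmul, count_roots]
    rw [← Polynomial.map_pow, ← Polynomial.map_mul]
    exact (Polynomial.map_ne_zero_iff (algebraMap K (AlgebraicClosure K)).injective).2 hP
  have hm1 := rootMultiplicity_map_le_one hn hq1 ζ
  have hm2 := rootMultiplicity_map_le_one hn (hdvd.trans hq1) ζ
  by_cases hcyc : IsPrimitiveRoot ζ n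
  · have h5 := van_lhsSum_sub_rhsSum hcyc hn1 hd hgcd hr hNn hc hc_root hden
    refine Van.mono (e := 5) (by omega) ?_
    rcases hM with rfl | rfl
    · exact h5
    · have h6 : Van ζ 5 (∑ k ∈ Finset.Ico (N + 1) n, qInt (RatFunc.X : RatFunc K) (2 * d * k + r) *
          lhsFactor RatFunc.X (RatFunc.C c) d r k) :=
        Van.sum _ fun k hk => by
          rw [Finset.mem_Ico] at hk
          exact van_lhsTerm_of_lt hcyc hn1 (Nat.Coprime.symm hgcd) hr hNn hc hc_root
            (by omega) hk.2
      convert h5.add h6 using 1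
      rw [lhsSum_eq, lhsSum_eq, Nat.sub_add_cancel hn,
        ← Finset.sum_range_add_sum_Ico _ (show N + 1 ≤ n by omega)]
      ring
  -- At a non-primitive root the cyclotomic factor contributes nothing, so a simple zero of each
  -- side suffices.
  · have hm3 : ((cyclotomic n K).map (algebraMap K (AlgebraicClosure K))).rootMultiplicity ζ = 0 := by
      rw [map_cyclotomic]
      have : NeZero (n : AlgebraicClosure K) := ⟨by exact_mod_cast hn.ne'⟩
      exact rootMultiplicity_eq_zero fun h => hcyc (isRoot_cyclotomic_iff.1 h)
    have hfin : 0 < orderOf ζ := orderOf_pos_iff.2 (isOfFinOrder_iff_pow_eq_one.2 ⟨n, hn, hζn⟩)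
    have hm : 1 < orderOf ζ := by
      have : orderOf ζ ≠ 1 := fun h => hζ1 (orderOf_eq_one_iff.1 h)
      omega
    have hmn : orderOf ζ ∣ n := orderOf_dvd_of_pow_eq_one hζn
    have hdm : Nat.Coprime d (orderOf ζ) := (Nat.Coprime.symm hgcd).coprime_dvd_right hmn
    have h1 := van_lhsSum (IsPrimitiveRoot.orderOf ζ) hm hn hmn hd hdm hr hc hc_root hM
    have h2 := van_rhsSum (IsPrimitiveRoot.orderOf ζ) hm hn hmn hd hdm hr hr0 hc hc_root hden
    exact (h1.sub h2).mono (by omega)
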